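/- Let $M$ be a smooth manifold and $\mathbb TM=TM\oplus T^*M$, with the pairing $\langle u+\xi,v+\eta\rangle=\eta(u)+\xi(v)$ and the Dorfman bracket $[u+\xi,v+\eta]=[u,v]+\mathscr L_u\eta-\iota_v\mathrm d\xi$. A \emph{Lagrangian family} $L$ on $M$ is a choice, without any regularity, of a Lagrangian subspace $L_x\subset\mathbb T_xM$ for every $x\in M$. Over an open set $U$ it is a \emph{Dirac structure} if $L|_U$ is a smooth vector subbundle of $\mathbb TM|_U$ whose smooth sections are closed under the Dorfman bracket; a Dirac structure on $M$ is the case $U=M$. A Lagrangian family is \emph{involutive} if it is a Dirac structure over some dense open subset of $M$. For Lagrangian families $L,R$ define pointwise the Lagrangian families $$L\star R=\{u+\xi+\eta \mid u+\xi\in L,\ u+\eta\in R\},\qquad L\circledast R=\{u+v+\xi \mid u+\xi\in L,\ v+\xi\in R\},$$ $$\mathcal R_{-1}(L)=\{u-\xi\mid u+\xi\in L\},$$ put $K(L)=L\cap TM$, and $\mathrm{Gr}(K)=K\oplus K^\circ$ for a family $K$ of subspaces of the tangent spaces. Say that $L$ and $R$ \emph{concur weakly} if $L\circledast R$ is involutive.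 The \emph{Magri recipe} is $$\mathscr M(L,R)=\mathrm{Gr}\bigl(K(L\star(R\circledast\mathcal R_{-1}(L)))\bigr).$$ \textbf{Theorem.} Let $L,R$ be Dirac structures on $M$ which concur weakly. Then $\mathscr M(L,R)$ and $\mathscr M(R,L)$ are involutive, and $L$, $R$, $\mathscr M(L,R)$, $\mathscr M(R,L)$ concur weakly pairwise. Moreover, if $L=\mathrm{Gr}(\pi_L)$ and $R=\mathrm{Gr}(\pi_R)$ are the graphs of Poisson structures, then $\mathscr M(L,R)=\mathrm{Gr}(\pi_L(\ker\pi_R))$ and $\mathscr M(R,L)=\mathrm{Gr}(\pi_R(\ker\pi_L))$. -/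

import Mathlib

open Set Bundle
open scoped Manifold ContDiff

noncomputable section

namespace DiracGeometry

/-! ### Linear algebra of `V ⊕ V*` -/

section LinearAlgebra

set_option linter.unusedSectionVars false

variable {V : Type*} [AddCommGroup V] [Module ℝ V] [TopologicalSpace V]
  [IsTopologicalAddGroup V] [ContinuousSMul ℝ V]

/-- The canonical symmetric pairing `⟨u + ξ, v + η⟩ = η(u) + ξ(v)` on `V ⊕ V*`. -/
def pairing (a b : V × (V →L[ℝ] ℝ)) : ℝ := b.2 a.1 + a.2 b.1

/-- A subspace of `V ⊕ V*` is Lagrangian when it equals its own orthogonal. -/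
def IsLagrangian (L : Submodule ℝ (V × (V →L[ℝ] ℝ))) : Prop :=
  ∀ a, a ∈ L ↔ ∀ b ∈ L, pairing a b = 0

/-- The tangent product `L ⋆ R = {u + ξ + η | u + ξ ∈ L, u + η ∈ R}`. -/
def tangentProd (L R : Submodule ℝ (V × (V →L[ℝ] ℝ))) : Submodule ℝ (V × (V →L[ℝ] ℝ)) where
  carrier := {c | ∃ a ∈ L, ∃ b ∈ R, a.1 = b.1 ∧ c = (a.1, a.2 + b.2)}
  zero_mem' := ⟨0, L.zero_mem, 0, R.zero_mem, rfl, by ext <;> simp⟩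
  add_mem' := by
    rintro _ _ ⟨a, ha, b, hb, h, rfl⟩ ⟨a', ha', b', hb', h', rfl⟩
    exact ⟨a + a', L.add_mem ha ha', b + b', R.add_mem hb hb', by simp [h, h'],
      by ext <;> simp; ring⟩
  smul_mem' := by
    rintro t _ ⟨a, ha, b, hb, h, rfl⟩
    exact ⟨t • a, L.smul_mem t ha, t • b, R.smul_mem t hb, by simp [h], by ext <;> simp⟩

/-- The cotangent product `L ⊛ R = {u + v + ξ | u + ξ ∈ L, v + ξ ∈ R}`. -/
def cotangentProd (L R : Submodule ℝ (V × (V →L[ℝ] ℝ))) : Submodule ℝ (V × (V →L[ℝ] ℝ)) where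
  carrier := {c | ∃ a ∈ L, ∃ b ∈ R, a.2 = b.2 ∧ c = (a.1 + b.1, a.2)}
  zero_mem' := ⟨0, L.zero_mem, 0, R.zero_mem, rfl, by ext <;> simp⟩
  add_mem' := by
    rintro _ _ ⟨a, ha, b, hb, h, rfl⟩ ⟨a', ha', b', hb', h', rfl⟩
    exact ⟨a + a', L.add_mem ha ha', b + b', R.add_mem hb hb', by simp [h, h'],
      Prod.ext (by simp; abel) (by simp)⟩
  smul_mem' := by
    rintro t _ ⟨a, ha, b, hb, h, rfl⟩
    exact ⟨t • a, L.smul_mem t ha, t • b, R.smul_mem t hb, by simp [h], by simp⟩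

/-- `ℛ₋₁(L) = {u - ξ | u + ξ ∈ L}`. -/
def negForm (L : Submodule ℝ (V × (V →L[ℝ] ℝ))) : Submodule ℝ (V × (V →L[ℝ] ℝ)) where
  carrier := {c | (c.1, -c.2) ∈ L}
  zero_mem' := by
    change ((0 : V), -(0 : V →L[ℝ] ℝ)) ∈ L
    rw [neg_zero]
    exact L.zero_mem
  add_mem' := by
    intro a b ha hb
    have := L.add_mem ha hb
    simpa [add_comm] using this
  smul_mem' := by
    intro t a ha
    have := L.smul_mem t ha
    simpa using this

/-- The kernel `K(L) = L ∩ V`, as a subspace of `V`. -/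
def kernel (L : Submodule ℝ (V × (V →L[ℝ] ℝ))) : Submodule ℝ V where
  carrier := {u | (u, 0) ∈ L}
  zero_mem' := L.zero_mem
  add_mem' := by
    intro a b ha hb
    simpa using L.add_mem ha hb
  smul_mem' := by
    intro t a ha
    simpa using L.smul_mem t ha

/-- `Gr(K) = K ⊕ K°`, where `K°` is the annihilator of `K`. -/
def graph (K : Submodule ℝ V) : Submodule ℝ (V × (V →L[ℝ] ℝ)) where
  carrier := {c | c.1 ∈ K ∧ ∀ k ∈ K, c.2 k = 0}
  zero_mem' := ⟨K.zero_mem, by simp⟩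
  add_mem' := by
    rintro a b ⟨ha, ha'⟩ ⟨hb, hb'⟩
    exact ⟨K.add_mem ha hb, fun k hk => by simp [ha' k hk, hb' k hk]⟩
  smul_mem' := by
    rintro t a ⟨ha, ha'⟩
    exact ⟨K.smul_mem t ha, fun k hk => by simp [ha' k hk]⟩

theorem exists_form_separating [T2Space V] [FiniteDimensional ℝ V] {W : Submodule ℝ V} {v : V}
    (hv : v ∉ W) : ∃ ξ : V →L[ℝ] ℝ, (∀ w ∈ W, ξ w = 0) ∧ ξ v ≠ 0 := by
  obtain ⟨f, hf, hW⟩ := Submodule.exists_le_ker_of_notMem hv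
  exact ⟨LinearMap.toContinuousLinearMap f, fun w hw => hW hw, hf⟩

theorem exists_vector_separating [T2Space V] [FiniteDimensional ℝ V]
    {P : Submodule ℝ (V →L[ℝ] ℝ)} {ζ : V →L[ℝ] ℝ}
    (hζ : ζ ∉ P) : ∃ v : V, (∀ ξ ∈ P, ξ v = 0) ∧ ζ v ≠ 0 := by
  obtain ⟨f, hf, hP⟩ := Submodule.exists_le_ker_of_notMem hζ
  set g : Module.Dual ℝ (Module.Dual ℝ V) :=
    f ∘ₗ (LinearMap.toContinuousLinearMap : (V →ₗ[ℝ] ℝ) ≃ₗ[ℝ] (V →L[ℝ] ℝ)).toLinearMap with hg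
  have key : ∀ ξ : V →L[ℝ] ℝ, f ξ = ξ ((Module.evalEquiv ℝ V).symm g) := by
    intro ξ
    have h := Module.apply_evalEquiv_symm_apply ℝ V (ξ : V →ₗ[ℝ] ℝ) g
    have h2 : g (ξ : V →ₗ[ℝ] ℝ) = f ξ := by
      simp only [hg, LinearMap.comp_apply]
      congr 1
    rw [← h2, ← h]
    rfl
  exact ⟨(Module.evalEquiv ℝ V).symm g, fun ξ hξ => by rw [← key]; exact hP hξ,
    by rw [← key]; exact hf⟩

theorem IsLagrangian.exists_vector [T2Space V] [FiniteDimensional ℝ V]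
    {L : Submodule ℝ (V × (V →L[ℝ] ℝ))} (hL : IsLagrangian L) {ζ : V →L[ℝ] ℝ}
    (h : ∀ v, (v, 0) ∈ L → ζ v = 0) : ∃ u, (u, ζ) ∈ L := by
  by_contra hne
  have : ζ ∉ L.map (LinearMap.snd ℝ V (V →L[ℝ] ℝ)) := by
    rintro ⟨⟨u, η⟩, hu, rfl⟩
    exact hne ⟨u, hu⟩
  obtain ⟨v, hv, hv'⟩ := exists_vector_separating this
  refine hv' (h v ((hL _).2 fun b hb => ?_))
  simp [pairing, hv b.2 ⟨b, hb, rfl⟩]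

theorem IsLagrangian.exists_form [T2Space V] [FiniteDimensional ℝ V]
    {L : Submodule ℝ (V × (V →L[ℝ] ℝ))} (hL : IsLagrangian L) {u : V}
    (h : ∀ ξ, (0, ξ) ∈ L → ξ u = 0) : ∃ ξ, (u, ξ) ∈ L := by
  by_contra hne
  have : u ∉ L.map (LinearMap.fst ℝ V (V →L[ℝ] ℝ)) := by
    rintro ⟨⟨u, η⟩, hu, rfl⟩
    exact hne ⟨η, hu⟩
  obtain ⟨ξ, hξ, hξ'⟩ := exists_form_separating this
  refine hξ' (h ξ ((hL _).2 fun b hb => ?_))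
  simp [pairing, hξ b.1 ⟨b, hb, rfl⟩]

theorem IsLagrangian.pairing_eq_zero {L : Submodule ℝ (V × (V →L[ℝ] ℝ))} (hL : IsLagrangian L)
    {a b : V × (V →L[ℝ] ℝ)} (ha : a ∈ L) (hb : b ∈ L) : pairing a b = 0 :=
  (hL a).1 ha b hb

theorem IsLagrangian.cotangentProd [T2Space V] [FiniteDimensional ℝ V]
    {L R : Submodule ℝ (V × (V →L[ℝ] ℝ))} (hL : IsLagrangian L) (hR : IsLagrangian R) :
    IsLagrangian (cotangentProd L R) := by
  rintro ⟨w, ζ⟩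
  constructor
  · rintro ⟨a, ha, b, hb, hab, h⟩ _ ⟨a', ha', b', hb', hab', rfl⟩
    obtain ⟨rfl, rfl⟩ := Prod.ext_iff.1 h
    have h1 := hL.pairing_eq_zero ha ha'
    have h2 := hR.pairing_eq_zero hb hb'
    simp only [pairing, ← hab, ← hab', map_add] at h1 h2 ⊢
    linarith
  · intro h
    obtain ⟨u, hu⟩ := hL.exists_vector (ζ := ζ) fun v hv => by
      simpa [pairing] using h (v, 0) ⟨(v, 0), hv, 0, R.zero_mem, rfl, by simp⟩
    obtain ⟨v, hv⟩ := hR.exists_vector (ζ := ζ) fun v hv => by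
      simpa [pairing] using h (v, 0) ⟨0, L.zero_mem, (v, 0), hv, rfl, by simp⟩
    have hk : w - u - v ∈ kernel L ⊔ kernel R := by
      by_contra hne
      obtain ⟨ξ, hξ, hξ'⟩ := exists_form_separating hne
      obtain ⟨u', hu'⟩ := hL.exists_vector (ζ := ξ) fun k hk =>
        hξ k (Submodule.mem_sup_left hk)
      obtain ⟨v', hv'⟩ := hR.exists_vector (ζ := ξ) fun k hk =>
        hξ k (Submodule.mem_sup_right hk)
      have h0 := h (u' + v', ξ) ⟨_, hu', _, hv', rfl, rfl⟩
      have h1 := hL.pairing_eq_zero hu hu'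
      have h2 := hR.pairing_eq_zero hv hv'
      simp only [pairing, map_add] at h0 h1 h2
      apply hξ'
      simp only [map_sub]
      linarith
    obtain ⟨k, hk, l, hl, hkl⟩ := Submodule.mem_sup.1 hk
    refine ⟨(u + k, ζ), ?_, (v + l, ζ), ?_, rfl, ?_⟩
    · simpa using L.add_mem hu hk
    · simpa using R.add_mem hv hl
    · ext
      · simp only
        rw [show u + k + (v + l) = (k + l) + u + v by abel, hkl]
        abel
      · rfl

theorem IsLagrangian.tangentProd [T2Space V] [FiniteDimensional ℝ V]
    {L R : Submodule ℝ (V × (V →L[ℝ] ℝ))} (hL : IsLagrangian L) (hR : IsLagrangian R) :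
    IsLagrangian (tangentProd L R) := by
  rintro ⟨w, ζ⟩
  constructor
  · rintro ⟨a, ha, b, hb, hab, h⟩ _ ⟨a', ha', b', hb', hab', rfl⟩
    obtain ⟨rfl, rfl⟩ := Prod.ext_iff.1 h
    have h1 := hL.pairing_eq_zero ha ha'
    have h2 := hR.pairing_eq_zero hb hb'
    simp only [pairing, ← hab, ← hab', _root_.add_apply] at h1 h2 ⊢
    linarith
  · intro h
    obtain ⟨ξ, hξ⟩ := hL.exists_form (u := w) fun ξ hξ => by
      simpa [pairing] using h (0, ξ) ⟨(0, ξ), hξ, 0, R.zero_mem, rfl, by simp⟩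
    obtain ⟨η, hη⟩ := hR.exists_form (u := w) fun ξ hξ => by
      simpa [pairing] using h (0, ξ) ⟨0, L.zero_mem, (0, ξ), hξ, rfl, by simp⟩
    have hk : ζ - ξ - η ∈ L.comap (LinearMap.inr ℝ V (V →L[ℝ] ℝ)) ⊔
        R.comap (LinearMap.inr ℝ V (V →L[ℝ] ℝ)) := by
      by_contra hne
      obtain ⟨u, hu, hu'⟩ := exists_vector_separating hne
      obtain ⟨ξ', hξ'⟩ := hL.exists_form (u := u) fun k hk =>
        hu k (Submodule.mem_sup_left hk)
      obtain ⟨η', hη'⟩ := hR.exists_form (u := u) fun k hk =>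
        hu k (Submodule.mem_sup_right hk)
      have h0 := h (u, ξ' + η') ⟨_, hξ', _, hη', rfl, rfl⟩
      have h1 := hL.pairing_eq_zero hξ hξ'
      have h2 := hR.pairing_eq_zero hη hη'
      simp only [pairing, _root_.add_apply] at h0 h1 h2
      apply hu'
      simp only [_root_.sub_apply]
      linarith
    obtain ⟨k, hk, l, hl, hkl⟩ := Submodule.mem_sup.1 hk
    refine ⟨(w, ξ + k), ?_, (w, η + l), ?_, rfl, ?_⟩
    · simpa using L.add_mem hξ hk
    · simpa using R.add_mem hη hl
    · refine Prod.ext rfl ?_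
      simp only
      rw [show ξ + k + (η + l) = (k + l) + ξ + η by abel, hkl]
      abel

theorem IsLagrangian.negForm {L : Submodule ℝ (V × (V →L[ℝ] ℝ))} (hL : IsLagrangian L) :
    IsLagrangian (negForm L) := by
  intro a
  change (a.1, -a.2) ∈ L ↔ _
  rw [hL]
  constructor
  · intro h b hb
    have h1 := h _ hb
    simp only [pairing, _root_.neg_apply] at h1 ⊢
    linarith
  · intro h b hb
    have h1 := h (b.1, -b.2) (by change (b.1, - -b.2) ∈ L; simpa using hb)
    simp only [pairing, _root_.neg_apply] at h1 ⊢
    linarith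

theorem isLagrangian_graph [T2Space V] [FiniteDimensional ℝ V] (K : Submodule ℝ V) :
    IsLagrangian (graph K) := by
  intro a
  constructor
  · rintro ⟨h1, h2⟩ b ⟨h3, h4⟩
    simp [pairing, h4 _ h1, h2 _ h3]
  · intro h
    refine ⟨?_, fun k hk => ?_⟩
    · by_contra hne
      obtain ⟨ξ, hξ, hξ'⟩ := exists_form_separating hne
      exact hξ' (by simpa [pairing] using h (0, ξ) ⟨K.zero_mem, hξ⟩)
    · simpa [pairing] using h (k, 0) ⟨hk, by simp⟩

end LinearAlgebra

/-! ### The generalized tangent bundle and the Dorfman bracket -/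

section Manifold

variable (E : Type*) [NormedAddCommGroup E] [NormedSpace ℝ E]

/-- The fibre `T_xM ⊕ T_x^*M` of the generalized tangent bundle of a manifold `M` modelled
on `E`. -/
abbrev GTangentSpace {M : Type*} [TopologicalSpace M] [ChartedSpace E M] (x : M) : Type _ :=
  TangentSpace 𝓘(ℝ, E) x × (TangentSpace 𝓘(ℝ, E) x →L[ℝ] ℝ)

variable {E}

/-- Lie derivative `ℒ_u η` of a one-form along a vector field on a vector space:
`(ℒ_u η)(w) = (D_u η)(w) + η(D_w u)`. -/
def lieDerivFormFlat (u : E → E) (η : E → E →L[ℝ] ℝ) (y : E) : E →L[ℝ] ℝ :=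
  fderiv ℝ η y (u y) + (η y).comp (fderiv ℝ u y)

/-- Contraction `ι_v dξ` of the exterior derivative of a one-form on a vector space:
`dξ(v, w) = (D_v ξ)(w) - (D_w ξ)(v)`. -/
def contractExtDerivFlat (v : E → E) (ξ : E → E →L[ℝ] ℝ) (y : E) : E →L[ℝ] ℝ :=
  fderiv ℝ ξ y (v y) - (fderiv ℝ ξ y).flip (v y)

variable {M : Type*} [TopologicalSpace M] [ChartedSpace E M]

/-- A vector field on `M`, read in the chart at `x₀`. -/
def chartField (x₀ : M) (u : ∀ x : M, TangentSpace 𝓘(ℝ, E) x) : E → E :=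
  VectorField.mpullback 𝓘(ℝ, E) 𝓘(ℝ, E) (extChartAt 𝓘(ℝ, E) x₀).symm u

/-- A one-form on `M`, read in the chart at `x₀`, i.e. pulled back by the inverse chart. -/
def chartForm (x₀ : M) (ξ : ∀ x : M, TangentSpace 𝓘(ℝ, E) x →L[ℝ] ℝ) : E → E →L[ℝ] ℝ :=
  fun y => (ξ ((extChartAt 𝓘(ℝ, E) x₀).symm y)).comp
    (mfderiv 𝓘(ℝ, E) 𝓘(ℝ, E) (extChartAt 𝓘(ℝ, E) x₀).symm y)

/-- The Dorfman bracket `[u + ξ, v + η] = [u, v] + ℒ_u η - ι_v dξ` at the point `x`. The bracket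
`[u, v]` is the Lie bracket of vector fields; the one-form `ℒ_u η - ι_v dξ` is computed in the
chart at `x` and pulled back to `M`. -/
def dorfman (a b : ∀ x : M, GTangentSpace E x) (x : M) : GTangentSpace E x :=
  (VectorField.mlieBracket 𝓘(ℝ, E) (fun y => (a y).1) (fun y => (b y).1) x,
    (lieDerivFormFlat (chartField x fun y => (a y).1) (chartForm x fun y => (b y).2)
          (extChartAt 𝓘(ℝ, E) x x)
        - contractExtDerivFlat (chartField x fun y => (b y).1) (chartForm x fun y => (a y).2)
          (extChartAt 𝓘(ℝ, E) x x)).comp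
      (mfderiv 𝓘(ℝ, E) 𝓘(ℝ, E) (extChartAt 𝓘(ℝ, E) x) x))

/-- Smoothness over `V` of a section of the generalized tangent bundle: both its vector part and
its form part are smooth sections, of `TM` and of `T^*M`. -/
def IsSmoothSectionOn [IsManifold 𝓘(ℝ, E) ∞ M] (a : ∀ x : M, GTangentSpace E x) (V : Set M) :
    Prop :=
  ContMDiffOn 𝓘(ℝ, E) (𝓘(ℝ, E).prod 𝓘(ℝ, E)) ∞
      (fun x => TotalSpace.mk' E (E := (TangentSpace 𝓘(ℝ, E) : M → Type _)) x (a x).1) V ∧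
    ContMDiffOn 𝓘(ℝ, E) (𝓘(ℝ, E).prod 𝓘(ℝ, E →L[ℝ] ℝ)) ∞
      (fun x => TotalSpace.mk' (E →L[ℝ] ℝ)
        (E := fun y : M => TangentSpace 𝓘(ℝ, E) y →L[ℝ] Bundle.Trivial M ℝ y) x (a x).2) V

variable (E M) in
/-- A Lagrangian family on `M`: a Lagrangian subspace of each fibre of the generalized tangent
bundle, without any regularity in the base point. -/
@[ext]
structure LagrangianFamily where
  /-- the subspace of the fibre at a point -/
  fiber : ∀ x : M, Submodule ℝ (GTangentSpace E x)
  isLagrangian : ∀ x, IsLagrangian (fiber x)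

instance instFiniteDimensionalTangentSpace [FiniteDimensional ℝ E] (x : M) :
    FiniteDimensional ℝ (TangentSpace 𝓘(ℝ, E) x) :=
  inferInstanceAs (FiniteDimensional ℝ E)

instance instT2SpaceTangentSpace (x : M) : T2Space (TangentSpace 𝓘(ℝ, E) x) :=
  inferInstanceAs (T2Space E)

namespace LagrangianFamily

section Dirac

variable [IsManifold 𝓘(ℝ, E) ∞ M]

/-- `a ∈ Γ(V, L)`: a smooth section over `V` with values in `L`. -/
def IsSectionOn (L : LagrangianFamily E M) (a : ∀ x : M, GTangentSpace E x) (V : Set M) : Prop :=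
  IsSmoothSectionOn a V ∧ ∀ x ∈ V, a x ∈ L.fiber x

/-- `L` is smooth over the open set `U`: over `U` it is a vector subbundle, i.e. it has smooth
local frames. -/
def IsSmoothOn (L : LagrangianFamily E M) (U : Set M) : Prop :=
  ∀ x ∈ U, ∃ V : Set M, IsOpen V ∧ x ∈ V ∧ V ⊆ U ∧
    ∃ (k : ℕ) (s : Fin k → ∀ y : M, GTangentSpace E y),
      (∀ i, IsSmoothSectionOn (s i) V) ∧
      ∀ y ∈ V, LinearIndependent ℝ (fun i => s i y) ∧
        Submodule.span ℝ (Set.range fun i => s i y) = L.fiber y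

/-- `L` is a Dirac structure over the open set `U`: it is smooth there, and its smooth sections
(over open subsets of `U`) are closed under the Dorfman bracket. -/
def IsDiracOn (L : LagrangianFamily E M) (U : Set M) : Prop :=
  L.IsSmoothOn U ∧
    ∀ V : Set M, IsOpen V → V ⊆ U → ∀ a b : (∀ x : M, GTangentSpace E x),
      L.IsSectionOn a V → L.IsSectionOn b V → ∀ x ∈ V, dorfman a b x ∈ L.fiber x

/-- Dirac structures on `M`. -/
def IsDirac (L : LagrangianFamily E M) : Prop := L.IsDiracOn Set.univ

/-- A Lagrangian family, not necessarily smooth, is involutive if it is a Dirac structure over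
some dense open subset of `M`. For a smooth Lagrangian family this means, by continuity, that it is
a Dirac structure on all of `M`. -/
def IsInvolutive (L : LagrangianFamily E M) : Prop :=
  ∃ U : Set M, IsOpen U ∧ Dense U ∧ L.IsDiracOn U

end Dirac

section Products

variable [FiniteDimensional ℝ E]

/-- The tangent product `L ⋆ R`. -/
def tangentProd (L R : LagrangianFamily E M) : LagrangianFamily E M where
  fiber x := DiracGeometry.tangentProd (L.fiber x) (R.fiber x)
  isLagrangian x := (L.isLagrangian x).tangentProd (R.isLagrangian x)

/-- The cotangent product `L ⊛ R`. -/
def cotangentProd (L R : LagrangianFamily E M) : LagrangianFamily E M where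
  fiber x := DiracGeometry.cotangentProd (L.fiber x) (R.fiber x)
  isLagrangian x := (L.isLagrangian x).cotangentProd (R.isLagrangian x)

/-- `ℛ₋₁(L)`. -/
def negForm (L : LagrangianFamily E M) : LagrangianFamily E M where
  fiber x := DiracGeometry.negForm (L.fiber x)
  isLagrangian x := (L.isLagrangian x).negForm

/-- The kernel `K(L) = L ∩ TM`. -/
def kernel (L : LagrangianFamily E M) (x : M) : Submodule ℝ (TangentSpace 𝓘(ℝ, E) x) :=
  DiracGeometry.kernel (L.fiber x)

/-- `Gr(K) = K ⊕ K°` for a family `K` of subspaces of the tangent spaces. -/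
def graph (K : ∀ x : M, Submodule ℝ (TangentSpace 𝓘(ℝ, E) x)) : LagrangianFamily E M where
  fiber x := DiracGeometry.graph (K x)
  isLagrangian x := isLagrangian_graph (K x)

/-- `𝒩(L, R) = L ⋆ (R ⊛ ℛ₋₁(L))`. -/
def magriN (L R : LagrangianFamily E M) : LagrangianFamily E M :=
  L.tangentProd (R.cotangentProd L.negForm)

/-- Magri's recipe `ℳ(L, R) = Gr(K(𝒩(L, R)))`. -/
def magri (L R : LagrangianFamily E M) : LagrangianFamily E M :=
  graph (magriN L R).kernel

/-- `L` and `R` concur weakly if `L ⊛ R` is involutive. -/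
def WeaklyConcur [IsManifold 𝓘(ℝ, E) ∞ M] (L R : LagrangianFamily E M) : Prop :=
  (L.cotangentProd R).IsInvolutive

/-- `L` is the graph `{P(ξ) + ξ}` of the field `P` of linear maps `T^*M → TM`. -/
def IsGraphOf (L : LagrangianFamily E M)
    (P : ∀ x : M, (TangentSpace 𝓘(ℝ, E) x →L[ℝ] ℝ) →ₗ[ℝ] TangentSpace 𝓘(ℝ, E) x) : Prop :=
  ∀ (x : M) (a : GTangentSpace E x), a ∈ L.fiber x ↔ a.1 = P x a.2

end Products

end LagrangianFamily

end Manifold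

end DiracGeometry

end

/-! A Lagrangian family S is closed under the Dorfman bracket exactly when the Courant form ⟨[a, b],
c⟩ vanishes for all smooth sections a, b of S and all values c of S at the point. Two things are
needed: smooth sections expressed through L and R, and identities between Courant forms.

Put K = K(L ⋆ (R ⊛ ℛ₋₁(L))). Linear algebra gives p ∈ K iff p + ζ ∈ L, r + ζ ∈ R, r ∈ L for some r,
ζ (`mem_magriKernel`), and ξ ∈ K° iff v + ξ ∈ L, v + η ∈ R, w + η ∈ L for some v, w, η
(`annihilates_magriKernel_iff`). So ℳ(L, R), and the cotangent products in the theorem that involve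
it, are outputs of finite systems of membership conditions in L and R, called schemes. The solutions
of a scheme form the kernel of a matrix depending smoothly on the point. Their dimension is upper
semicontinuous, hence locally constant on a dense open set, and there the kernels form a smooth
bundle. The outputs form a Lagrangian family, so their rank is dim M; therefore they form a smooth
subbundle whose sections lift to smooth solutions. `Scheme.isInvolutive` combines this with the
dense open set over which L ⊛ R is Dirac.

For smooth solutions the bracket identities are pure algebra. Since L, R and L ⊛ R are Dirac, their
Courant forms vanish; subtracting the first two from the third leaves an identity in the mixed
terms, `ConcurAt.cross`. Linear combinations of these three identities show that K is involutive
(`ConcurAt.kernel_involutive`), that the form part of the bracket of two sections of L, or of R,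
with forms in K° again annihilates K (`ConcurAt.annihilator_left`, `ConcurAt.annihilator_right`),
and that brackets between the two Magri distributions are killed by the common annihilators
(`ConcurAt.mixed_bracket`). `courant_graph` and `courant_add_graph` reduce every claim to these
facts. -/

noncomputable section

namespace DiracGeometry

open Filter Topology

/-! ### Bracket identities in a vector space -/

section Flat

variable {E : Type*} [NormedAddCommGroup E] [NormedSpace ℝ E]

/-- The function `f` is smooth in a neighbourhood of `y`. -/
def SmoothNear {F : Type*} [NormedAddCommGroup F] [NormedSpace ℝ F] (f : E → F) (y : E) : Prop :=
  ∀ᶠ z in 𝓝 y, ContDiffAt ℝ ∞ f z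

theorem SmoothNear.contDiffAt {F : Type*} [NormedAddCommGroup F] [NormedSpace ℝ F] {f : E → F}
    {y : E} (h : SmoothNear f y) : ContDiffAt ℝ ∞ f y := h.self_of_nhds

theorem SmoothNear.differentiableAt {F : Type*} [NormedAddCommGroup F] [NormedSpace ℝ F]
    {f : E → F} {y : E} (h : SmoothNear f y) : DifferentiableAt ℝ f y :=
  h.contDiffAt.differentiableAt (by simp)

theorem SmoothNear.add {F : Type*} [NormedAddCommGroup F] [NormedSpace ℝ F] {f g : E → F}
    {y : E} (hf : SmoothNear f y) (hg : SmoothNear g y) : SmoothNear (f + g) y := by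
  filter_upwards [hf, hg] with z h1 h2 using h1.add h2

theorem SmoothNear.const {F : Type*} [NormedAddCommGroup F] [NormedSpace ℝ F] (c : F) (y : E) :
    SmoothNear (fun _ : E => c) y := Eventually.of_forall fun _ => contDiffAt_const

theorem SmoothNear.zero {F : Type*} [NormedAddCommGroup F] [NormedSpace ℝ F] (y : E) :
    SmoothNear (0 : E → F) y := SmoothNear.const 0 y

/-- The Dorfman bracket of two sections of `E × E*`, for a vector space `E`. -/
def flatDorfman (a b : E → E × (E →L[ℝ] ℝ)) (y : E) : E × (E →L[ℝ] ℝ) :=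
  (VectorField.lieBracket ℝ (fun z => (a z).1) (fun z => (b z).1) y,
    lieDerivFormFlat (fun z => (a z).1) (fun z => (b z).2) y
      - contractExtDerivFlat (fun z => (b z).1) (fun z => (a z).2) y)

/-- The Courant trilinear form `⟨[u + ξ, u' + ξ'], x + α⟩` at the point `y`. -/
def courant (y : E) (u : E → E) (ξ : E → E →L[ℝ] ℝ) (u' : E → E) (ξ' : E → E →L[ℝ] ℝ)
    (x : E) (α : E →L[ℝ] ℝ) : ℝ :=
  α (fderiv ℝ u' y (u y)) - α (fderiv ℝ u y (u' y)) + fderiv ℝ ξ' y (u y) x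
    + ξ' y (fderiv ℝ u y x) - fderiv ℝ ξ y (u' y) x + fderiv ℝ ξ y x (u' y)

theorem pairing_flatDorfman (a b : E → E × (E →L[ℝ] ℝ)) (y : E) (c : E × (E →L[ℝ] ℝ)) :
    pairing (flatDorfman a b y) c = courant y (fun z => (a z).1) (fun z => (a z).2)
      (fun z => (b z).1) (fun z => (b z).2) c.1 c.2 := by
  simp only [pairing, flatDorfman, courant, VectorField.lieBracket, lieDerivFormFlat,
    contractExtDerivFlat, map_sub, _root_.sub_apply, _root_.add_apply,
    ContinuousLinearMap.comp_apply, ContinuousLinearMap.flip_apply]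
  ring

/-- Smooth sections, defined near `y`, of a family of subspaces of `E × E*` are closed under the
Dorfman bracket at the point `y`. -/
def FlatDiracAt (S : E → Submodule ℝ (E × (E →L[ℝ] ℝ))) (y : E) : Prop :=
  ∀ a b : E → E × (E →L[ℝ] ℝ), SmoothNear a y → SmoothNear b y →
    (∀ᶠ z in 𝓝 y, a z ∈ S z) → (∀ᶠ z in 𝓝 y, b z ∈ S z) → flatDorfman a b y ∈ S y

/-- `u + ξ` is a smooth section near `y` of the family `S`. -/
structure IsSec (S : E → Submodule ℝ (E × (E →L[ℝ] ℝ))) (y : E) (u : E → E)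
    (ξ : E → E →L[ℝ] ℝ) : Prop where
  vec : SmoothNear u y
  form : SmoothNear ξ y
  mem : ∀ᶠ z in 𝓝 y, (u z, ξ z) ∈ S z

theorem IsSec.zero (S : E → Submodule ℝ (E × (E →L[ℝ] ℝ))) (y : E) : IsSec S y 0 0 :=
  ⟨SmoothNear.zero y, SmoothNear.zero y, Eventually.of_forall fun z => (S z).zero_mem⟩

variable {L R : E → Submodule ℝ (E × (E →L[ℝ] ℝ))} {y : E}

/-- The third argument enters only through its value at `y`, so it ranges over all of `L y` and no
smooth extension of it is required. -/
theorem FlatDiracAt.courant_eq_zero (h : FlatDiracAt L y) (hL : IsLagrangian (L y))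
    {u : E → E} {ξ : E → E →L[ℝ] ℝ} {u' : E → E} {ξ' : E → E →L[ℝ] ℝ}
    {x : E} {α : E →L[ℝ] ℝ} (hu : IsSec L y u ξ) (hu' : IsSec L y u' ξ') (hx : (x, α) ∈ L y) :
    courant y u ξ u' ξ' x α = 0 := by
  have := hL.pairing_eq_zero (h (fun z => (u z, ξ z)) (fun z => (u' z, ξ' z))
    (by filter_upwards [hu.vec, hu.form] with z h1 h2 using h1.prodMk h2)
    (by filter_upwards [hu'.vec, hu'.form] with z h1 h2 using h1.prodMk h2) hu.mem hu'.mem) hx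
  rwa [pairing_flatDorfman] at this

/-- Lagrangian families near `y` which are Dirac at `y`, as is their cotangent product. -/
structure ConcurAt (L R : E → Submodule ℝ (E × (E →L[ℝ] ℝ))) (y : E) : Prop where
  left_lagrangian : ∀ᶠ z in 𝓝 y, IsLagrangian (L z)
  right_lagrangian : ∀ᶠ z in 𝓝 y, IsLagrangian (R z)
  prod_lagrangian : IsLagrangian (cotangentProd (L y) (R y))
  left : FlatDiracAt L y
  right : FlatDiracAt R y
  prod : FlatDiracAt (fun z => cotangentProd (L z) (R z)) y

theorem cotangentProd_comm {V : Type*} [AddCommGroup V] [Module ℝ V] [TopologicalSpace V]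
    [IsTopologicalAddGroup V] [ContinuousSMul ℝ V] (L R : Submodule ℝ (V × (V →L[ℝ] ℝ))) :
    cotangentProd L R = cotangentProd R L := by
  ext c
  constructor <;> rintro ⟨a, ha, b, hb, h, rfl⟩ <;>
    exact ⟨b, hb, a, ha, h.symm, by rw [h, add_comm]⟩

namespace ConcurAt

theorem symm (h : ConcurAt L R y) : ConcurAt R L y where
  left_lagrangian := h.right_lagrangian
  right_lagrangian := h.left_lagrangian
  prod_lagrangian := by rw [cotangentProd_comm]; exact h.prod_lagrangian
  left := h.right
  right := h.left
  prod := by simpa only [cotangentProd_comm] using h.prod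

variable (h : ConcurAt L R y)
include h

theorem left_courant {u : E → E} {ξ : E → E →L[ℝ] ℝ} {u' : E → E} {ξ' : E → E →L[ℝ] ℝ}
    {x : E} {α : E →L[ℝ] ℝ} (hu : IsSec L y u ξ) (hu' : IsSec L y u' ξ') (hx : (x, α) ∈ L y) :
    courant y u ξ u' ξ' x α = 0 :=
  h.left.courant_eq_zero h.left_lagrangian.self_of_nhds hu hu' hx

theorem right_courant {u : E → E} {ξ : E → E →L[ℝ] ℝ} {u' : E → E} {ξ' : E → E →L[ℝ] ℝ}
    {x : E} {α : E →L[ℝ] ℝ} (hu : IsSec R y u ξ) (hu' : IsSec R y u' ξ') (hx : (x, α) ∈ R y) :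
    courant y u ξ u' ξ' x α = 0 :=
  h.symm.left_courant hu hu' hx

/-- The mixed terms in the Courant trilinear form of `L ⊛ R`. -/
theorem cross {u v : E → E} {ξ : E → E →L[ℝ] ℝ} {u' v' : E → E} {ξ' : E → E →L[ℝ] ℝ}
    {x z : E} {α : E →L[ℝ] ℝ} (hu : IsSec L y u ξ) (hv : IsSec R y v ξ)
    (hu' : IsSec L y u' ξ') (hv' : IsSec R y v' ξ') (hx : (x, α) ∈ L y) (hz : (z, α) ∈ R y) :
    α (fderiv ℝ v' y (u y)) - α (fderiv ℝ u y (v' y)) + α (fderiv ℝ u' y (v y))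
      - α (fderiv ℝ v y (u' y))
      + (fderiv ℝ ξ' y (u y) z + ξ' y (fderiv ℝ u y z))
      + (fderiv ℝ ξ' y (v y) x + ξ' y (fderiv ℝ v y x))
      - (fderiv ℝ ξ y (u' y) z - fderiv ℝ ξ y z (u' y))
      - (fderiv ℝ ξ y (v' y) x - fderiv ℝ ξ y x (v' y)) = 0 := by
  -- The Courant form of L ⊛ R at the sums u + v, u' + v', x + z expands into the forms of L and of
  -- R plus the mixed terms.
  have h1 := h.left_courant hu hu' hx
  have h2 := h.right_courant hv hv' hz
  have h3 := h.prod.courant_eq_zero h.prod_lagrangian (u := u + v) (ξ := ξ) (u' := u' + v')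
    (ξ' := ξ') (x := x + z) (α := α)
    ⟨hu.vec.add hv.vec, hu.form, by
      filter_upwards [hu.mem, hv.mem] with w h1 h2 using ⟨_, h1, _, h2, rfl, rfl⟩⟩
    ⟨hu'.vec.add hv'.vec, hu'.form, by
      filter_upwards [hu'.mem, hv'.mem] with w h1 h2 using ⟨_, h1, _, h2, rfl, rfl⟩⟩
    ⟨_, hx, _, hz, rfl, rfl⟩
  simp only [courant, fderiv_add hu.vec.differentiableAt hv.vec.differentiableAt,
    fderiv_add hu'.vec.differentiableAt hv'.vec.differentiableAt, map_add, _root_.add_apply,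
    Pi.add_apply] at h1 h2 h3
  linarith

end ConcurAt

/-- Leibniz rule for a vanishing pairing of a one-form with a vector field. -/
theorem fderiv_apply_eq_zero {ξ : E → E →L[ℝ] ℝ} {u : E → E} (hξ : SmoothNear ξ y)
    (hu : SmoothNear u y) (h : ∀ᶠ z in 𝓝 y, ξ z (u z) = 0) (w : E) :
    fderiv ℝ ξ y w (u y) + ξ y (fderiv ℝ u y w) = 0 := by
  have h1 : fderiv ℝ (fun z => ξ z (u z)) y = 0 := by
    rw [EventuallyEq.fderiv_eq (f₁ := fun z => ξ z (u z)) (f := fun _ => (0 : ℝ)) h]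
    simp
  rw [fderiv_clm_apply hξ.differentiableAt hu.differentiableAt] at h1
  have h2 := congrArg (fun f : E →L[ℝ] ℝ => f w) h1
  simp at h2
  linarith

/-- Data `p + ζ ∈ L`, `r + ζ ∈ R`, `r ∈ L` exhibiting `p` as a section of the distribution
`K(L ⋆ (R ⊛ ℛ₋₁(L)))`. -/
structure KernelData (L R : E → Submodule ℝ (E × (E →L[ℝ] ℝ))) (y : E) (p r : E → E)
    (ζ : E → E →L[ℝ] ℝ) : Prop where
  left : IsSec L y p ζ
  right : IsSec R y r ζ
  ker : IsSec L y r 0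

/-- Data `v + ξ ∈ L`, `v + η ∈ R`, `w + η ∈ L` exhibiting `ξ` as a section of the annihilator of
`K(L ⋆ (R ⊛ ℛ₋₁(L)))`. -/
structure AnnihilatorData (L R : E → Submodule ℝ (E × (E →L[ℝ] ℝ))) (y : E) (v w : E → E)
    (ξ η : E → E →L[ℝ] ℝ) : Prop where
  left : IsSec L y v ξ
  right : IsSec R y v η
  aux : IsSec L y w η

/-- Isotropy of L, R, L in turn gives ξ(p) = -ζ(v) = η(r) = 0. -/
theorem apply_eq_zero_of_data {V : Type*} [AddCommGroup V] [Module ℝ V] [TopologicalSpace V]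
    [IsTopologicalAddGroup V] [ContinuousSMul ℝ V] {L R : Submodule ℝ (V × (V →L[ℝ] ℝ))}
    (hL : IsLagrangian L) (hR : IsLagrangian R) {p r v w : V} {ζ ξ η : V →L[ℝ] ℝ}
    (h1 : (p, ζ) ∈ L) (h2 : (r, ζ) ∈ R) (h3 : (r, 0) ∈ L)
    (h4 : (v, ξ) ∈ L) (h5 : (v, η) ∈ R) (h6 : (w, η) ∈ L) : ξ p = 0 := by
  have e1 := hL.pairing_eq_zero h1 h4
  have e2 := hR.pairing_eq_zero h2 h5
  have e3 := hL.pairing_eq_zero h3 h6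
  simp [pairing] at e1 e2 e3
  linarith

namespace ConcurAt

variable {p r p' r' v w v' w' u u' : E → E} {ζ ζ' ξ η ξ' η' : E → E →L[ℝ] ℝ}

theorem eventually_apply_eq_zero (h : ConcurAt L R y) (hp : KernelData L R y p r ζ)
    (hv : AnnihilatorData L R y v w ξ η) : ∀ᶠ z in 𝓝 y, ξ z (p z) = 0 := by
  filter_upwards [h.left_lagrangian, h.right_lagrangian, hp.left.mem, hp.right.mem, hp.ker.mem,
    hv.left.mem, hv.right.mem, hv.aux.mem] with z h1 h2 h3 h4 h5 h6 h7 h8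
  exact apply_eq_zero_of_data h1 h2 h3 h4 h5 h6 h7 h8

/-- Sections of `K(L ⋆ (R ⊛ ℛ₋₁(L)))` are closed under the Lie bracket. -/
theorem kernel_involutive (h : ConcurAt L R y) (hp : KernelData L R y p r ζ)
    (hp' : KernelData L R y p' r' ζ') (hv : AnnihilatorData L R y v w ξ η) :
    ξ y (fderiv ℝ p' y (p y)) - ξ y (fderiv ℝ p y (p' y)) = 0 := by
  have hw := hv.aux.mem.self_of_nhds
  -- Subtracting `h2` and `h3` from the mixed identity removes the terms η([p, r']), η([r, p']) and
  -- all terms evaluated at w. What remains is the form part of [p + ζ, p' + ζ'] evaluated at v,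
  -- which by `h4` equals -ξ([p, p']).
  have h1 := h.cross hp.left hp.right hp'.left hp'.right hw hv.right.mem.self_of_nhds
  have h2 := h.left_courant hp.ker hp'.left hw
  have h3 := h.left_courant hp.left hp'.ker hw
  have h4 := h.left_courant hp.left hp'.left hv.left.mem.self_of_nhds
  simp only [courant, fderiv_zero, Pi.zero_apply, _root_.zero_apply] at h1 h2 h3 h4
  linarith

/-- Since L is Dirac, the form part of [v + ξ, v' + ξ'] takes the value -ζ([v, v']) on p. Since R is
Dirac, this is the value on r of the form part of [v + η, v' + η']. The latter vanishes by the mixed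
identity for w + η, v + η and w' + η', v' + η', with r ∈ L and 0 ∈ R in third place. -/
theorem annihilator_left (h : ConcurAt L R y) (hv : AnnihilatorData L R y v w ξ η)
    (hv' : AnnihilatorData L R y v' w' ξ' η') (hp : KernelData L R y p r ζ) :
    fderiv ℝ ξ' y (v y) (p y) + ξ' y (fderiv ℝ v y (p y)) - fderiv ℝ ξ y (v' y) (p y)
      + fderiv ℝ ξ y (p y) (v' y) = 0 := by
  have h1 := h.left_courant hv.left hv'.left hp.left.mem.self_of_nhds
  have h2 := h.right_courant hv.right hv'.right hp.right.mem.self_of_nhds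
  have h3 := h.cross hv.aux hv.right hv'.aux hv'.right hp.ker.mem.self_of_nhds
    (R y).zero_mem
  simp only [courant, map_zero, Pi.zero_apply, _root_.zero_apply] at h1 h2 h3
  linarith

/-- The mixed identity at p + ζ ∈ L, r + ζ ∈ R expresses the form part of [u + ξ, u' + ξ'] on p
through ζ([v, u']), ζ([u, v']) and the form part of [v + ξ, v' + ξ'] on r. The last is zero because
r ∈ L. Because R is Dirac, the other two equal, up to sign, the form parts of [v + η, u' + ξ'] and
[u + ξ, v' + η'] on r, and these vanish by mixed identities with third entries r ∈ L and 0 ∈ R. -/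
theorem annihilator_right (h : ConcurAt L R y) (hv : AnnihilatorData L R y v w ξ η)
    (hu : IsSec R y u ξ) (hv' : AnnihilatorData L R y v' w' ξ' η') (hu' : IsSec R y u' ξ')
    (hp : KernelData L R y p r ζ) :
    fderiv ℝ ξ' y (u y) (p y) + ξ' y (fderiv ℝ u y (p y)) - fderiv ℝ ξ y (u' y) (p y)
      + fderiv ℝ ξ y (p y) (u' y) = 0 := by
  have hr := hp.right.mem.self_of_nhds
  have hk := hp.ker.mem.self_of_nhds
  have h1 := h.cross hv.left hu hv'.left hu' hp.left.mem.self_of_nhds hr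
  have h2 := h.left_courant hv.left hv'.left hk
  have h3 := h.right_courant hv.right hu' hr
  have h4 := h.right_courant hu hv'.right hr
  have h5 := h.cross hv.left hu hv'.aux hv'.right hk (R y).zero_mem
  have h6 := h.cross hv.aux hv.right hv'.left hu' hk (R y).zero_mem
  simp only [courant, map_zero, Pi.zero_apply, _root_.zero_apply] at h1 h2 h3 h4 h5 h6
  linarith

end ConcurAt

/-- The Courant trilinear form vanishes on the graph of an involutive distribution. -/
theorem courant_graph {p p' p'' : E → E} {ξ ξ' ξ'' : E → E →L[ℝ] ℝ}
    (hp' : SmoothNear p' y) (hp'' : SmoothNear p'' y)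
    (hξ : SmoothNear ξ y) (hξ' : SmoothNear ξ' y)
    (h1 : ∀ᶠ z in 𝓝 y, ξ' z (p'' z) = 0) (h2 : ∀ᶠ z in 𝓝 y, ξ z (p' z) = 0)
    (h3 : ∀ᶠ z in 𝓝 y, ξ z (p'' z) = 0)
    (i1 : ξ'' y (fderiv ℝ p' y (p y)) - ξ'' y (fderiv ℝ p y (p' y)) = 0)
    (i2 : ξ' y (fderiv ℝ p'' y (p y)) - ξ' y (fderiv ℝ p y (p'' y)) = 0)
    (i3 : ξ y (fderiv ℝ p'' y (p' y)) - ξ y (fderiv ℝ p' y (p'' y)) = 0) :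
    courant y p ξ p' ξ' (p'' y) (ξ'' y) = 0 := by
  -- Differentiating the vanishing pairings turns the Courant form into ξ''([p, p']) - ξ'([p, p''])
  -- + ξ([p', p'']).
  have e1 := fderiv_apply_eq_zero hξ' hp'' h1 (p y)
  have e2 := fderiv_apply_eq_zero hξ hp' h2 (p'' y)
  have e3 := fderiv_apply_eq_zero hξ hp'' h3 (p' y)
  simp only [courant]
  linarith

/-- The Courant trilinear form of the cotangent product of a family with the graph of a
distribution. -/
theorem courant_add_graph {u u' u'' p p' p'' : E → E} {ξ ξ' ξ'' : E → E →L[ℝ] ℝ}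
    (hu : SmoothNear u y) (hu' : SmoothNear u' y)
    (hp : SmoothNear p y) (hp' : SmoothNear p' y)
    (hξ' : SmoothNear ξ' y) (hξ'' : SmoothNear ξ'' y)
    (o1 : ∀ᶠ z in 𝓝 y, ξ'' z (p' z) = 0) (o2 : ∀ᶠ z in 𝓝 y, ξ' z (p z) = 0)
    (o3 : ∀ᶠ z in 𝓝 y, ξ'' z (p z) = 0)
    (h1 : courant y u ξ u' ξ' (u'' y) (ξ'' y) = 0)
    (h2 : courant y p ξ p' ξ' (p'' y) (ξ'' y) = 0)
    (a1 : fderiv ℝ ξ' y (u y) (p'' y) + ξ' y (fderiv ℝ u y (p'' y)) - fderiv ℝ ξ y (u' y) (p'' y)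
      + fderiv ℝ ξ y (p'' y) (u' y) = 0)
    (a2 : fderiv ℝ ξ'' y (u y) (p' y) + ξ'' y (fderiv ℝ u y (p' y)) - fderiv ℝ ξ y (u'' y) (p' y)
      + fderiv ℝ ξ y (p' y) (u'' y) = 0)
    (a3 : fderiv ℝ ξ'' y (u' y) (p y) + ξ'' y (fderiv ℝ u' y (p y)) - fderiv ℝ ξ' y (u'' y) (p y)
      + fderiv ℝ ξ' y (p y) (u'' y) = 0) :
    courant y (u + p) ξ (u' + p') ξ' (u'' y + p'' y) (ξ'' y) = 0 := by
  -- Beyond `h1` and `h2`, only terms mixing the u's with the p's remain. Each of `a1`, `a2`, `a3`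
  -- says that the form part of a bracket of two of the sections u + ξ kills one of the p's; modulo
  -- the Leibniz rules, the mixed terms are a1 - a2 + a3.
  have e1 := fderiv_apply_eq_zero hξ'' hp' o1 (u y)
  have e2 := fderiv_apply_eq_zero hξ' hp o2 (u'' y)
  have e3 := fderiv_apply_eq_zero hξ'' hp o3 (u' y)
  simp only [courant, fderiv_add hu.differentiableAt hp.differentiableAt,
    fderiv_add hu'.differentiableAt hp'.differentiableAt, map_add, _root_.add_apply,
    Pi.add_apply] at h1 h2 ⊢
  linarith

namespace ConcurAt

variable {k r k' r' v w v' w' : E → E} {ζ ζ' ξ η η' : E → E →L[ℝ] ℝ}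

/-- The form ζ' itself annihilates the first Magri distribution, because r' + ζ' ∈ L, r' ∈ R and 0 ∈
L. Hence `annihilator_right` applies to the sections k' + ζ' and v' + ξ of R, and the Leibniz rules
for ξ(k) = 0 and ζ'(k) = 0 bring the result into this form. -/
theorem mixed_aux (h : ConcurAt L R y) (hk : KernelData L R y k r ζ)
    (hk' : KernelData R L y k' r' ζ') (hv : AnnihilatorData L R y v w ξ η)
    (hv' : IsSec R y v' ξ) :
    ξ y (fderiv ℝ k' y (k y)) - ξ y (fderiv ℝ k y (k' y)) + fderiv ℝ ζ' y (k y) (v' y)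
      + ζ' y (fderiv ℝ k y (v' y)) = 0 := by
  have hz : AnnihilatorData L R y r' 0 ζ' 0 := ⟨hk'.right, hk'.ker, IsSec.zero _ _⟩
  have h1 := h.annihilator_right hz hk'.left hv hv' hk
  have e1 := fderiv_apply_eq_zero hv.left.form hk.left.vec (h.eventually_apply_eq_zero hk hv)
    (k' y)
  have e2 := fderiv_apply_eq_zero hk'.left.form hk.left.vec (h.eventually_apply_eq_zero hk hz)
    (v' y)
  linarith

/-- The mixed identity yields only the sum ξ([k, k']) + ξ([r, r']) = 0. Applied a second time to the
auxiliary vectors r and r', whose own auxiliary vectors are zero, it gives ξ([r, r']) = 0. -/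
theorem mixed_bracket (h : ConcurAt L R y) (hk : KernelData L R y k r ζ)
    (hk' : KernelData R L y k' r' ζ') (hv : AnnihilatorData L R y v w ξ η)
    (hv' : AnnihilatorData R L y v' w' ξ η') :
    ξ y (fderiv ℝ k' y (k y)) - ξ y (fderiv ℝ k y (k' y)) = 0 := by
  have key : ∀ {k r k' r' : E → E} {ζ ζ' : E → E →L[ℝ] ℝ}, KernelData L R y k r ζ →
      KernelData R L y k' r' ζ' →
      ξ y (fderiv ℝ k' y (k y)) - ξ y (fderiv ℝ k y (k' y))
        + (ξ y (fderiv ℝ r' y (r y)) - ξ y (fderiv ℝ r y (r' y))) = 0 := by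
    intro k r k' r' ζ ζ' hk hk'
    have m1 := h.mixed_aux hk hk' hv hv'.left
    have m2 := h.symm.mixed_aux hk' hk hv' hv.left
    -- Put X = ξ([k, k']) and Y = ξ([r, r']). The identities `m1`, `m2` (with `e`), `l`, `l'`
    -- evaluate the form terms of `c` as -X, -X, -Y, -Y, so `c` reads -(X + Y) = 0.
    have c := h.cross hk.left hk.right hk'.right hk'.left hv.left.mem.self_of_nhds
      hv'.left.mem.self_of_nhds
    have l := h.left_courant hk.ker hk'.right hv.left.mem.self_of_nhds
    have l' := h.right_courant hk.right hk'.ker hv'.left.mem.self_of_nhds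
    have hz : AnnihilatorData R L y r 0 ζ 0 := ⟨hk.right, hk.ker, IsSec.zero _ _⟩
    have e := fderiv_apply_eq_zero hk.left.form hk'.left.vec
      (h.symm.eventually_apply_eq_zero hk' hz) (v y)
    simp only [courant, fderiv_zero, Pi.zero_apply, _root_.zero_apply] at l l'
    linarith
  have hk0 : KernelData L R y r 0 0 := ⟨hk.ker, IsSec.zero _ _, IsSec.zero _ _⟩
  have hk0' : KernelData R L y r' 0 0 := ⟨hk'.ker, IsSec.zero _ _, IsSec.zero _ _⟩
  have e1 := key hk hk'
  have e2 := key hk0 hk0'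
  simp at e2
  linarith

end ConcurAt

end Flat

/-! ### Linear algebra of Magri's recipe -/

section MagriAlgebra

variable {V : Type*} [AddCommGroup V] [Module ℝ V] [TopologicalSpace V]
  [IsTopologicalAddGroup V] [ContinuousSMul ℝ V]

/-- The kernel in Magri's recipe, as a subspace of `V`. -/
abbrev magriKernel (L R : Submodule ℝ (V × (V →L[ℝ] ℝ))) : Submodule ℝ V :=
  kernel (tangentProd L (cotangentProd R (negForm L)))

omit [IsTopologicalAddGroup V] [ContinuousSMul ℝ V] in
theorem mem_magriKernel {L R : Submodule ℝ (V × (V →L[ℝ] ℝ))} {p : V} :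
    p ∈ magriKernel L R ↔ ∃ r ζ, (p, ζ) ∈ L ∧ (r, ζ) ∈ R ∧ (r, 0) ∈ L := by
  constructor
  · rintro ⟨⟨u, ξ⟩, ha, _, ⟨⟨r, α⟩, hb, ⟨l, β⟩, hc, h1, rfl⟩, h2, h3⟩
    obtain ⟨rfl, h4⟩ := Prod.ext_iff.1 h3
    change α = β at h1
    change p = r + l at h2
    change 0 = ξ + α at h4
    change (l, -β) ∈ L at hc
    subst h1
    obtain rfl : ξ = -α := eq_neg_of_add_eq_zero_left h4.symm
    -- Both p - α and l - α lie in L, hence so does their difference l - p = -r.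
    refine ⟨-r, -α, ha, by simpa using R.neg_mem hb, ?_⟩
    have := L.sub_mem hc ha
    simpa [h2] using this
  · rintro ⟨r, ζ, h1, h2, h3⟩
    refine ⟨(p, ζ), h1, (p, -ζ), ⟨(-r, -ζ), by simpa using R.neg_mem h2, (p + r, -ζ), ?_, rfl, ?_⟩,
      rfl, ?_⟩
    · change (p + r, - -ζ) ∈ L
      simpa using L.add_mem h1 h3
    · simp
    · simp

omit [IsTopologicalAddGroup V] [ContinuousSMul ℝ V] in
theorem mem_magriKernel_of_mem {L R : Submodule ℝ (V × (V →L[ℝ] ℝ))} {p : V}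
    (hp : (p, 0) ∈ L) : p ∈ magriKernel L R :=
  mem_magriKernel.2 ⟨0, 0, hp, R.zero_mem, L.zero_mem⟩

variable [T2Space V] [FiniteDimensional ℝ V]

theorem annihilates_magriKernel_iff {L R : Submodule ℝ (V × (V →L[ℝ] ℝ))}
    (hL : IsLagrangian L) (hR : IsLagrangian R) {ξ : V →L[ℝ] ℝ} :
    (∀ p ∈ magriKernel L R, ξ p = 0) ↔
      ∃ v w η, (v, ξ) ∈ L ∧ (v, η) ∈ R ∧ (w, η) ∈ L := by
  constructor
  · intro h
    obtain ⟨u, hu⟩ := hL.exists_vector (ζ := ξ) fun v hv => h v (mem_magriKernel_of_mem hv)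
    have hRA := hR.cotangentProd (isLagrangian_graph (kernel L))
    -- The aim is u = v + a with a ∈ K(L), v + η ∈ R and η ∈ K(L)°. Otherwise some ζ with ζ(u) ≠ 0
    -- kills all such vectors, and the Lagrangian property puts 0 + ζ in R ⊛ Gr(K(L)). Unfolding
    -- that membership produces p ∈ K with p + ζ ∈ L, whence ζ(u) = -ξ(p) = 0.
    have hu' : u ∈ (cotangentProd R (graph (kernel L))).map (LinearMap.fst ℝ V (V →L[ℝ] ℝ)) := by
      by_contra hne
      obtain ⟨ζ, hζ, hζu⟩ := exists_form_separating hne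
      have hmem : (0, ζ) ∈ cotangentProd R (graph (kernel L)) :=
        (hRA _).2 fun b hb => by simpa [pairing] using hζ b.1 ⟨b, hb, rfl⟩
      obtain ⟨⟨r, α⟩, hr, ⟨a, β⟩, ha, h1, h2⟩ := hmem
      obtain ⟨h3, rfl⟩ := Prod.ext_iff.1 h2
      change ζ = β at h1
      subst h1
      change 0 = r + a at h3
      obtain ⟨p, hp⟩ := hL.exists_vector (ζ := ζ) fun v hv => ha.2 v hv
      have hra : r = -a := eq_neg_of_add_eq_zero_left h3.symm
      have hrL : (r, (0 : V →L[ℝ] ℝ)) ∈ L := by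
        rw [hra]
        exact (kernel L).neg_mem ha.1
      have e1 := h p (mem_magriKernel.2 ⟨r, ζ, hp, hr, hrL⟩)
      have e2 := hL.pairing_eq_zero hp hu
      simp only [pairing, e1] at e2
      exact hζu (by simpa using e2)
    obtain ⟨_, ⟨⟨v, η⟩, hv, ⟨a, β⟩, ha, h1, rfl⟩, h2⟩ := hu'
    change η = β at h1
    subst h1
    change v + a = u at h2
    obtain ⟨w, hw⟩ := hL.exists_vector (ζ := η) fun k hk => ha.2 k hk
    refine ⟨v, w, η, ?_, hv, hw⟩
    have h3 := L.sub_mem hu (show (a, (0 : V →L[ℝ] ℝ)) ∈ L from ha.1)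
    simpa [← h2] using h3
  · rintro ⟨v, w, η, h1, h2, h3⟩ p hp
    obtain ⟨r, ζ, h4, h5, h6⟩ := mem_magriKernel.1 hp
    exact apply_eq_zero_of_data hL hR h4 h5 h6 h1 h2 h3

theorem mem_graph_magriKernel_iff {L R : Submodule ℝ (V × (V →L[ℝ] ℝ))}
    (hL : IsLagrangian L) (hR : IsLagrangian R) {c : V × (V →L[ℝ] ℝ)} :
    c ∈ graph (magriKernel L R) ↔ (∃ r ζ, (c.1, ζ) ∈ L ∧ (r, ζ) ∈ R ∧ (r, 0) ∈ L) ∧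
      ∃ v w η, (v, c.2) ∈ L ∧ (v, η) ∈ R ∧ (w, η) ∈ L :=
  and_congr mem_magriKernel (annihilates_magriKernel_iff hL hR)

/-- A Lagrangian subspace of `V ⊕ V*` has the dimension of `V`. -/
theorem IsLagrangian.finrank_eq {L : Submodule ℝ (V × (V →L[ℝ] ℝ))} (hL : IsLagrangian L) :
    Module.finrank ℝ L = Module.finrank ℝ V := by
  let B : LinearMap.BilinForm ℝ (V × (V →L[ℝ] ℝ)) :=
    LinearMap.mk₂ ℝ (fun a b => pairing a b) (fun a a' b => by simp [pairing]; ring)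
      (fun t a b => by simp [pairing]; ring) (fun a b b' => by simp [pairing]; ring)
      (fun t a b => by simp [pairing]; ring)
  have hB : ∀ a b, B a b = pairing a b := fun a b => rfl
  have hsymm : B.IsRefl := fun a b h => by
    rw [hB] at h ⊢
    simp only [pairing] at h ⊢
    linarith
  have hnd : B.Nondegenerate := by
    have hleft : LinearMap.SeparatingLeft B := by
      intro a ha
      have h1 : a.2 = 0 := by
        ext v
        simpa [hB, pairing] using ha (v, 0)
      have h2 : a.1 = 0 := by
        by_contra hne
        obtain ⟨ξ, -, hξ⟩ := exists_form_separating (W := (⊥ : Submodule ℝ V)) (v := a.1)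
          (by simpa using hne)
        exact hξ (by simpa [hB, pairing] using ha (0, ξ))
      exact Prod.ext h2 h1
    exact (LinearMap.IsRefl.nondegenerate_iff_separatingLeft hsymm).2 hleft
  -- A self-orthogonal subspace for a nondegenerate form has half the dimension of the space, here 2
  -- dim V.
  have horth : B.orthogonal L = L := by
    ext a
    rw [LinearMap.BilinForm.mem_orthogonal_iff, hL a]
    refine forall₂_congr fun b _ => ?_
    change pairing b a = 0 ↔ _
    simp only [pairing, add_comm]
  have h := LinearMap.BilinForm.finrank_orthogonal hnd L
  rw [horth, Module.finrank_prod,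
    ← (LinearMap.toContinuousLinearMap : (V →ₗ[ℝ] ℝ) ≃ₗ[ℝ] (V →L[ℝ] ℝ)).finrank_eq,
    Subspace.dual_finrank_eq] at h
  have h' := Submodule.finrank_le L
  rw [Module.finrank_prod,
    ← (LinearMap.toContinuousLinearMap : (V →ₗ[ℝ] ℝ) ≃ₗ[ℝ] (V →L[ℝ] ℝ)).finrank_eq,
    Subspace.dual_finrank_eq] at h'
  omega

end MagriAlgebra

/-- A system of conditions on finitely many vectors and one-forms: each condition asks that a
given vector plus a given one-form (or zero) lie in a given one of two families of subspaces. The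
output of the system is the sum of some of the vectors plus one of the forms. -/
structure Scheme where
  /-- the number of vectors -/
  vecs : ℕ
  /-- the number of one-forms -/
  forms : ℕ
  /-- the number of conditions -/
  conds : ℕ
  /-- the family in each condition -/
  side : Fin conds → Bool
  /-- the vector in each condition -/
  vec : Fin conds → Fin vecs
  /-- the one-form in each condition -/
  form : Fin conds → Option (Fin forms)
  /-- the vectors to be summed for the output -/
  outVec : Finset (Fin vecs)
  /-- the output one-form -/
  outForm : Fin forms

/-! ### Linear systems of membership conditions -/

namespace Scheme

variable (C : Scheme) {V : Type*} [AddCommGroup V] [Module ℝ V] [TopologicalSpace V]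
  [IsTopologicalAddGroup V] [ContinuousSMul ℝ V]

/-- The vectors and one-forms of a scheme. -/
abbrev Data (V : Type*) [AddCommGroup V] [Module ℝ V] [TopologicalSpace V] : Type _ :=
  (Fin C.vecs → V) × (Fin C.forms → V →L[ℝ] ℝ)

/-- The vector plus one-form occurring in a condition. -/
def sel (j : Fin C.conds) : C.Data V →ₗ[ℝ] V × (V →L[ℝ] ℝ) where
  toFun h := (h.1 (C.vec j), (C.form j).elim 0 h.2)
  map_add' h h' := by cases hj : C.form j <;> simp
  map_smul' t h := by cases hj : C.form j <;> simp

/-- The output of a scheme. -/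
def output : C.Data V →ₗ[ℝ] V × (V →L[ℝ] ℝ) where
  toFun h := (∑ i ∈ C.outVec, h.1 i, h.2 C.outForm)
  map_add' h h' := by simp [Finset.sum_add_distrib]
  map_smul' t h := by simp [Finset.smul_sum]

/-- The data satisfying the conditions of a scheme. -/
def solutions (S : Bool → Submodule ℝ (V × (V →L[ℝ] ℝ))) : Submodule ℝ (C.Data V) :=
  ⨅ j, (S (C.side j)).comap (C.sel j)

variable {C}

omit [IsTopologicalAddGroup V] [ContinuousSMul ℝ V] in
theorem mem_solutions {S : Bool → Submodule ℝ (V × (V →L[ℝ] ℝ))} {h : C.Data V} :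
    h ∈ C.solutions S ↔ ∀ j, (h.1 (C.vec j), (C.form j).elim 0 h.2) ∈ S (C.side j) := by
  simp only [solutions, Submodule.mem_iInf, Submodule.mem_comap]
  rfl

variable {W : Type*} [AddCommGroup W] [Module ℝ W] [TopologicalSpace W]
  [IsTopologicalAddGroup W] [ContinuousSMul ℝ W]

/-- The action of a linear isomorphism on the data of a scheme. -/
def dataCongr (C : Scheme) (g : V ≃L[ℝ] W) : C.Data V ≃ₗ[ℝ] C.Data W where
  toFun h := (fun i => g (h.1 i), fun i => (h.2 i).comp (g.symm : W →L[ℝ] V))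
  map_add' h h' := by ext <;> simp
  map_smul' t h := by ext <;> simp
  invFun h := (fun i => g.symm (h.1 i), fun i => (h.2 i).comp (g : V →L[ℝ] W))
  left_inv h := by ext <;> simp
  right_inv h := by ext <;> simp

variable {S : Bool → Submodule ℝ (V × (V →L[ℝ] ℝ))} {S' : Bool → Submodule ℝ (W × (W →L[ℝ] ℝ))}
  {g : V ≃L[ℝ] W}

omit [IsTopologicalAddGroup V] [ContinuousSMul ℝ V] [IsTopologicalAddGroup W] [ContinuousSMul ℝ W] in
theorem dataCongr_mem_solutions
    (hS : ∀ b v ξ, (g v, ξ.comp (g.symm : W →L[ℝ] V)) ∈ S' b ↔ (v, ξ) ∈ S b) (h : C.Data V) :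
    C.dataCongr g h ∈ C.solutions S' ↔ h ∈ C.solutions S := by
  simp only [mem_solutions]
  refine forall_congr' fun j => ?_
  rw [← hS]
  cases hj : C.form j <;> simp [dataCongr]

omit [IsTopologicalAddGroup V] [ContinuousSMul ℝ V] [IsTopologicalAddGroup W] [ContinuousSMul ℝ W] in
theorem finrank_solutions_congr
    (hS : ∀ b v ξ, (g v, ξ.comp (g.symm : W →L[ℝ] V)) ∈ S' b ↔ (v, ξ) ∈ S b) :
    Module.finrank ℝ (C.solutions S) = Module.finrank ℝ (C.solutions S') := by
  refine LinearEquiv.finrank_eq ((C.dataCongr g).ofSubmodules _ _ ?_)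
  ext h
  simp only [Submodule.mem_map]
  constructor
  · rintro ⟨h', h1, rfl⟩
    exact (dataCongr_mem_solutions hS h').2 h1
  · intro hh
    exact ⟨(C.dataCongr g).symm h, (dataCongr_mem_solutions hS _).1 (by simpa using hh), by simp⟩

omit [IsTopologicalAddGroup V] [ContinuousSMul ℝ V] [IsTopologicalAddGroup W] [ContinuousSMul ℝ W] in
theorem map_output_congr
    (hS : ∀ b v ξ, (g v, ξ.comp (g.symm : W →L[ℝ] V)) ∈ S' b ↔ (v, ξ) ∈ S b) (v : V)
    (ξ : V →L[ℝ] ℝ) :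
    (g v, ξ.comp (g.symm : W →L[ℝ] V)) ∈ (C.solutions S').map C.output ↔
      (v, ξ) ∈ (C.solutions S).map C.output := by
  simp only [Submodule.mem_map]
  constructor
  · rintro ⟨h, h1, h2⟩
    refine ⟨(C.dataCongr g).symm h, (dataCongr_mem_solutions hS _).1 (by simpa using h1), ?_⟩
    obtain ⟨h3, h4⟩ := Prod.ext_iff.1 h2
    refine Prod.ext ?_ ?_
    · change ∑ i ∈ C.outVec, g.symm (h.1 i) = v
      rw [← map_sum]
      exact g.symm_apply_eq.2 h3
    · change (h.2 C.outForm).comp (g : V →L[ℝ] W) = ξ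
      change h.2 C.outForm = _ at h4
      rw [h4]
      ext
      simp
  · rintro ⟨h, h1, h2⟩
    refine ⟨C.dataCongr g h, (dataCongr_mem_solutions hS _).2 h1, ?_⟩
    obtain ⟨h3, h4⟩ := Prod.ext_iff.1 h2
    refine Prod.ext ?_ ?_
    · change ∑ i ∈ C.outVec, g (h.1 i) = g v
      rw [← map_sum]
      exact congrArg g h3
    · exact congrArg (fun ξ : V →L[ℝ] ℝ => ξ.comp (g.symm : W →L[ℝ] V)) h4

end Scheme

/-! ### Kernels and images of smooth families of linear maps -/

section SmoothFamilies

variable {E : Type*} [NormedAddCommGroup E] [NormedSpace ℝ E]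
  {F G H : Type*} [NormedAddCommGroup F] [NormedSpace ℝ F] [NormedAddCommGroup G]
  [NormedSpace ℝ G] [NormedAddCommGroup H] [NormedSpace ℝ H] {y : E}

theorem SmoothNear.clm_comp {f : E → G →L[ℝ] H} {g : E → F →L[ℝ] G} (hf : SmoothNear f y)
    (hg : SmoothNear g y) : SmoothNear (fun z => (f z).comp (g z)) y := by
  filter_upwards [hf, hg] with z h1 h2 using h1.clm_comp h2

theorem SmoothNear.clm_apply {f : E → G →L[ℝ] H} {g : E → G} (hf : SmoothNear f y)
    (hg : SmoothNear g y) : SmoothNear (fun z => f z (g z)) y := by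
  filter_upwards [hf, hg] with z h1 h2 using h1.clm_apply h2

theorem SmoothNear.continuousAt {f : E → F} (hf : SmoothNear f y) : ContinuousAt f y :=
  hf.contDiffAt.continuousAt

/-- A smooth family of linear maps which is invertible at `y` is invertible near `y`, with smooth
inverse. -/
theorem SmoothNear.inverse [FiniteDimensional ℝ F] {B : E → F →L[ℝ] G} (hB : SmoothNear B y)
    (h : (B y).IsInvertible) :
    SmoothNear (fun z => (B z).inverse) y ∧ ∀ᶠ z in 𝓝 y, (B z).IsInvertible := by
  have : CompleteSpace F := FiniteDimensional.complete ℝ F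
  obtain ⟨e, he⟩ := h
  have hev : ∀ᶠ z in 𝓝 y, (B z).IsInvertible := by
    have h1 := e.nhds
    rw [he] at h1
    exact hB.continuousAt.eventually h1
  refine ⟨?_, hev⟩
  filter_upwards [hB, hev] with z h1 ⟨e', h2⟩
  have h3 := contDiffAt_map_inverse (n := ∞) e'
  rw [h2] at h3
  exact ContDiffAt.comp z h3 h1

variable [FiniteDimensional ℝ H]

/-- Near `y`, the kernels of a smooth family of linear maps are contained in the ranges of a smooth
family of injective linear maps defined on the kernel at `y`. -/
theorem exists_smooth_kernel [FiniteDimensional ℝ G] {A : E → H →L[ℝ] G} (hA : SmoothNear A y) :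
    ∃ Ψ : E → (A y).ker →L[ℝ] H, SmoothNear Ψ y ∧ (∀ k, Ψ y k = k) ∧
      ∀ᶠ z in 𝓝 y, Function.Injective (Ψ z) ∧ (A z).ker ≤ (Ψ z).range := by
  obtain ⟨pr, hpr⟩ := Submodule.ClosedComplemented.of_finiteDimensional (𝕜 := ℝ) (A y).ker
  obtain ⟨P, hP⟩ := Submodule.ClosedComplemented.of_finiteDimensional (𝕜 := ℝ) (A y).range
  -- `B` is invertible at `y`, hence nearby. A vector h in the kernel of `A z` satisfies `B z h =
  -- (pr h, 0)`, so the inverse of `B z` restricted to the first factor covers that kernel, and at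
  -- `y` it is the inclusion.
  let B : E → H →L[ℝ] (A y).ker × (A y).range := fun z => pr.prod (P.comp (A z))
  have hB : SmoothNear B y := by
    have hsum : B = fun z => (ContinuousLinearMap.inl ℝ _ _).comp pr +
        (ContinuousLinearMap.inr ℝ _ _).comp (P.comp (A z)) := by
      funext z
      ext h <;> simp [B]
    rw [hsum]
    filter_upwards [hA] with z hz
    exact contDiffAt_const.add (contDiffAt_const.clm_comp (contDiffAt_const.clm_comp hz))
  have hinj : Function.Injective (B y) := by
    rw [injective_iff_map_eq_zero]
    intro h hh
    obtain ⟨h1, h2⟩ := Prod.ext_iff.1 hh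
    change pr h = 0 at h1
    change P (A y h) = 0 at h2
    have h3 : A y h = 0 := by
      have := hP ⟨A y h, h, rfl⟩
      rw [h2] at this
      exact (congrArg Subtype.val this).symm
    have h4 := hpr ⟨h, h3⟩
    rw [h1] at h4
    exact (congrArg Subtype.val h4).symm
  have hdim : Module.finrank ℝ H = Module.finrank ℝ ((A y).ker × (A y).range) := by
    rw [Module.finrank_prod, add_comm]
    exact ((A y : H →ₗ[ℝ] G).finrank_range_add_finrank_ker).symm
  have hBinv : (B y).IsInvertible :=
    ⟨(LinearEquiv.ofInjectiveOfFinrankEq (B y : H →ₗ[ℝ] _) hinj hdim).toContinuousLinearEquiv,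
      by ext h <;> rfl⟩
  obtain ⟨h1, h2⟩ := hB.inverse hBinv
  refine ⟨fun z => (B z).inverse.comp (ContinuousLinearMap.inl ℝ _ _),
    h1.clm_comp (SmoothNear.const _ _), fun k => ?_, ?_⟩
  · change (B y).inverse (k, 0) = k
    rw [hBinv.inverse_apply_eq]
    refine Prod.ext (hpr k).symm ?_
    change 0 = P (A y k)
    rw [show A y k = 0 from k.2, map_zero]
  · filter_upwards [h2] with z hz
    refine ⟨hz.inverse.injective.comp (LinearMap.inl_injective (R := ℝ)), fun h hh => ⟨pr h, ?_⟩⟩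
    change (B z).inverse (pr h, 0) = h
    rw [hz.inverse_apply_eq]
    refine Prod.ext rfl ?_
    change 0 = P (A z h)
    rw [show A z h = 0 from hh, map_zero]

omit [FiniteDimensional ℝ H] in
/-- If the images `S z` of the ranges of a smooth family of linear maps under a fixed linear map
have constant dimension, then they form a smooth family, and their elements lift smoothly. -/
theorem exists_smooth_image {K : Type*} [NormedAddCommGroup K] [NormedSpace ℝ K]
    [FiniteDimensional ℝ K] [FiniteDimensional ℝ G] {Ψ : E → K →L[ℝ] H} (hΨ : SmoothNear Ψ y)
    (f : H →L[ℝ] G) {S : E → Submodule ℝ G}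
    (hS : ∀ᶠ z in 𝓝 y, S z = (Ψ z).range.map (f : H →ₗ[ℝ] G))
    (hdim : ∀ᶠ z in 𝓝 y, Module.finrank ℝ (S z) = Module.finrank ℝ (S y)) :
    ∃ (k : ℕ) (s : Fin k → E → G) (T : E → G →L[ℝ] H), (∀ i, SmoothNear (s i) y) ∧
      SmoothNear T y ∧ ∀ᶠ z in 𝓝 y, LinearIndependent ℝ (fun i => s i z) ∧
        Submodule.span ℝ (Set.range fun i => s i z) = S z ∧
        ∀ x ∈ S z, T z x ∈ (Ψ z).range ∧ f (T z x) = x := by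
  have hex : ∀ x : S y, ∃ k, f (Ψ y k) = x := by
    rintro ⟨x, hx⟩
    rw [hS.self_of_nhds] at hx
    obtain ⟨_, ⟨k, rfl⟩, h⟩ := hx
    exact ⟨k, h⟩
  let b := Module.finBasis ℝ (S y)
  choose k hk using fun i => hex (b i)
  let σ : S y →L[ℝ] K := LinearMap.toContinuousLinearMap (b.constr ℝ k)
  have hσ : ∀ x : S y, f (Ψ y (σ x)) = x := by
    have : ((f : H →ₗ[ℝ] G) ∘ₗ (Ψ y : K →ₗ[ℝ] H)) ∘ₗ (b.constr ℝ k) = (S y).subtype := by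
      refine b.ext fun i => ?_
      simpa using hk i
    exact fun x => congrArg (fun g : S y →ₗ[ℝ] G => g x) this
  obtain ⟨ℓ, hℓ⟩ := Submodule.ClosedComplemented.of_finiteDimensional (𝕜 := ℝ) (S y)
  -- The section `σ` is chosen at `y` alone. As `ℓ ∘ Γ y` is the identity, `ℓ ∘ Γ z` stays
  -- invertible near `y`; so `Γ z` is injective, and equality of dimensions makes it a
  -- parametrization of `S z`, inverted there by `(ℓ ∘ Γ z)⁻¹ ∘ ℓ`.
  let Γ : E → S y →L[ℝ] G := fun z => f.comp ((Ψ z).comp σ)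
  have hΓ : SmoothNear Γ y :=
    (SmoothNear.const f y).clm_comp (hΨ.clm_comp (SmoothNear.const σ y))
  have hD : SmoothNear (fun z => ℓ.comp (Γ z)) y := (SmoothNear.const ℓ y).clm_comp hΓ
  have hDy : (ℓ.comp (Γ y)).IsInvertible := by
    have : ℓ.comp (Γ y) = ContinuousLinearMap.id ℝ _ := by
      ext x
      change ((ℓ (f (Ψ y (σ x))) : S y) : G) = x
      rw [hσ, hℓ]
    rw [this]
    exact ⟨ContinuousLinearEquiv.refl ℝ _, rfl⟩
  obtain ⟨h1, h2⟩ := hD.inverse hDy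
  refine ⟨_, fun i z => Γ z (b i), fun z => (Ψ z).comp (σ.comp ((ℓ.comp (Γ z)).inverse.comp ℓ)),
    fun i => hΓ.clm_apply (SmoothNear.const _ _),
    hΨ.clm_comp ((SmoothNear.const σ y).clm_comp (h1.clm_comp (SmoothNear.const ℓ y))), ?_⟩
  filter_upwards [h2, hS, hdim] with z hz hSz hdz
  have hinj : Function.Injective (Γ z) := fun x x' hxx => hz.injective (congrArg ℓ hxx)
  have hrange : (Γ z).range = S z := by
    refine Submodule.eq_of_le_of_finrank_eq ?_ ?_
    · rintro _ ⟨x, rfl⟩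
      rw [hSz]
      exact ⟨_, ⟨σ x, rfl⟩, rfl⟩
    · rw [hdz]
      exact LinearMap.finrank_range_of_inj hinj
  refine ⟨b.linearIndependent.map' (Γ z : S y →ₗ[ℝ] G) (LinearMap.ker_eq_bot.2 hinj), ?_,
    fun x hx => ⟨⟨_, rfl⟩, ?_⟩⟩
  · have := Submodule.map_span (Γ z : S y →ₗ[ℝ] G) (Set.range b)
    rw [Module.Basis.span_eq, Submodule.map_top, ← Set.range_comp, hrange] at this
    exact this.symm
  rw [← hrange] at hx
  obtain ⟨c, rfl⟩ := hx
  change Γ z ((ℓ.comp (Γ z)).inverse (ℓ (Γ z c))) = Γ z c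
  exact congrArg _ (hz.inverse_apply_self c)

end SmoothFamilies

/-! ### Smooth solutions of schemes at regular points -/

section FlatSchemes

variable {E : Type*} [NormedAddCommGroup E] [NormedSpace ℝ E]

/-- The family of subspaces `S` has a smooth frame near `y`. -/
def FlatSmoothAt (S : E → Submodule ℝ (E × (E →L[ℝ] ℝ))) (y : E) : Prop :=
  ∃ (k : ℕ) (s : Fin k → E → E × (E →L[ℝ] ℝ)), (∀ i, SmoothNear (s i) y) ∧
    ∀ᶠ z in 𝓝 y, LinearIndependent ℝ (fun i => s i z) ∧
      Submodule.span ℝ (Set.range fun i => s i z) = S z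

variable [FiniteDimensional ℝ E] {S : Bool → E → Submodule ℝ (E × (E →L[ℝ] ℝ))} {y : E}

-- A smooth frame of a Lagrangian family thus supplies linear equations for it with smooth
-- coefficients.
omit [FiniteDimensional ℝ E] in
theorem IsLagrangian.mem_iff_of_span {L : Submodule ℝ (E × (E →L[ℝ] ℝ))} (hL : IsLagrangian L)
    {ι : Type*} {s : ι → E × (E →L[ℝ] ℝ)} (hs : Submodule.span ℝ (Set.range s) = L)
    (a : E × (E →L[ℝ] ℝ)) : a ∈ L ↔ ∀ i, pairing a (s i) = 0 := by
  rw [hL a]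
  refine ⟨fun h i => h _ (hs ▸ Submodule.subset_span ⟨i, rfl⟩), fun h b hb => ?_⟩
  rw [← hs] at hb
  induction hb using Submodule.span_induction with
  | mem x hx => obtain ⟨i, rfl⟩ := hx; exact h i
  | zero => simp [pairing]
  | add x x' _ _ h1 h2 =>
    simp only [pairing, Prod.fst_add, Prod.snd_add, map_add, _root_.add_apply] at h1 h2 ⊢
    linarith
  | smul t x _ h1 =>
    simp only [pairing, Prod.smul_fst, Prod.smul_snd, map_smul, _root_.smul_apply,
      smul_eq_mul] at h1 ⊢
    rw [← mul_add, h1, mul_zero]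

namespace Scheme

/-- The solutions of a scheme for smooth Lagrangian families are the kernels of a smooth family of
linear maps. -/
theorem exists_solutions_eq_ker (C : Scheme) (hS : ∀ b, FlatSmoothAt (S b) y)
    (hL : ∀ b, ∀ᶠ z in 𝓝 y, IsLagrangian (S b z)) :
    ∃ (m : Type) (_ : Fintype m) (A : E → C.Data E →L[ℝ] (m → ℝ)), SmoothNear A y ∧
      ∀ᶠ z in 𝓝 y, C.solutions (fun b => S b z) = (A z).ker := by
  choose k s hs hspan using hS
  let P : E × (E →L[ℝ] ℝ) → E × (E →L[ℝ] ℝ) →ₗ[ℝ] ℝ := fun b =>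
    { toFun := fun a => pairing a b
      map_add' := fun a a' => by simp [pairing]; ring
      map_smul' := fun t a => by simp [pairing]; ring }
  let A : E → C.Data E →L[ℝ] ((Σ j, Fin (k (C.side j))) → ℝ) := fun z =>
    LinearMap.toContinuousLinearMap
      (LinearMap.pi fun p => (P (s (C.side p.1) p.2 z)).comp (C.sel p.1))
  refine ⟨_, inferInstance, A, ?_, ?_⟩
  · have hall : ∀ᶠ z in 𝓝 y, ∀ b i, ContDiffAt ℝ ∞ (s b i) z := by
      rw [eventually_all]
      intro b
      rw [eventually_all]
      exact hs b
    have : ∃ U ∈ 𝓝 y, IsOpen U ∧ ∀ z ∈ U, ∀ b i, ContDiffAt ℝ ∞ (s b i) z := by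
      obtain ⟨U, hU, hU', hy⟩ := eventually_nhds_iff.1 hall
      exact ⟨U, hU'.mem_nhds hy, hU', hU⟩
    obtain ⟨U, hU, hUo, hUs⟩ := this
    have hA : ContDiffOn ℝ ∞ A U := by
      rw [contDiffOn_clm_apply]
      intro h
      rw [contDiffOn_pi]
      intro p z hz
      have h1 := hUs z hz (C.side p.1) p.2
      have : ContDiffAt ℝ ∞ (fun z => (s (C.side p.1) p.2 z).2 (C.sel p.1 h).1
          + (C.sel p.1 h).2 (s (C.side p.1) p.2 z).1) z :=
        (h1.snd.clm_apply contDiffAt_const).add (contDiffAt_const.clm_apply h1.fst)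
      exact this.contDiffWithinAt
    filter_upwards [hUo.mem_nhds (mem_of_mem_nhds hU)] with z hz
    exact (hA z hz).contDiffAt (hUo.mem_nhds hz)
  · have h1 : ∀ᶠ z in 𝓝 y, ∀ b, IsLagrangian (S b z) ∧
        Submodule.span ℝ (Set.range fun i => s b i z) = S b z := by
      rw [eventually_all]
      intro b
      filter_upwards [hL b, hspan b] with z h1 h2 using ⟨h1, h2.2⟩
    filter_upwards [h1] with z hz
    ext h
    simp only [solutions, Submodule.mem_iInf, Submodule.mem_comap]
    rw [LinearMap.mem_ker]
    constructor
    · intro hh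
      funext p
      exact ((hz _).1.mem_iff_of_span (hz _).2 _).1 (hh p.1) p.2
    · intro hh j
      exact ((hz _).1.mem_iff_of_span (hz _).2 _).2 fun i =>
        congrArg (fun g : (Σ j, Fin (k (C.side j))) → ℝ => g ⟨j, i⟩) hh

/-- The dimension of the space of solutions is upper semicontinuous. -/
theorem eventually_finrank_solutions_le (C : Scheme) (hS : ∀ b, FlatSmoothAt (S b) y)
    (hL : ∀ b, ∀ᶠ z in 𝓝 y, IsLagrangian (S b z)) :
    ∀ᶠ z in 𝓝 y, Module.finrank ℝ (C.solutions fun b => S b z) ≤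
      Module.finrank ℝ (C.solutions fun b => S b y) := by
  obtain ⟨m, _, A, hA, hker⟩ := C.exists_solutions_eq_ker hS hL
  obtain ⟨Ψ, -, -, h⟩ := exists_smooth_kernel hA
  filter_upwards [h, hker] with z h1 h2
  rw [h2, hker.self_of_nhds]
  exact (Submodule.finrank_mono h1.2).trans (LinearMap.finrank_range_of_inj h1.1).le

/-- Where the space of solutions has locally constant dimension, a Lagrangian family of outputs is
smooth, its smooth sections lift to smooth families of solutions, and every output extends to the
output of a smooth family of solutions. -/
theorem smooth_lifts (C : Scheme) (hS : ∀ b, FlatSmoothAt (S b) y)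
    (hL : ∀ b, ∀ᶠ z in 𝓝 y, IsLagrangian (S b z))
    (hdim : ∀ᶠ z in 𝓝 y, Module.finrank ℝ (C.solutions fun b => S b z) =
      Module.finrank ℝ (C.solutions fun b => S b y))
    {D : E → Submodule ℝ (E × (E →L[ℝ] ℝ))} (hDL : ∀ᶠ z in 𝓝 y, IsLagrangian (D z))
    (hD : ∀ᶠ z in 𝓝 y, D z = (C.solutions fun b => S b z).map C.output) :
    FlatSmoothAt D y ∧
    (∀ a : E → E × (E →L[ℝ] ℝ), SmoothNear a y → (∀ᶠ z in 𝓝 y, a z ∈ D z) →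
      ∃ t : E → C.Data E, SmoothNear t y ∧ ∀ᶠ z in 𝓝 y, t z ∈ C.solutions (fun b => S b z) ∧
        C.output (t z) = a z) ∧
    ∀ c ∈ D y, ∃ t : E → C.Data E, SmoothNear t y ∧
      (∀ᶠ z in 𝓝 y, t z ∈ C.solutions (fun b => S b z)) ∧ C.output (t y) = c := by
  obtain ⟨m, _, A, hA, hker⟩ := C.exists_solutions_eq_ker hS hL
  obtain ⟨Ψ, hΨ, hΨy, h⟩ := exists_smooth_kernel hA
  have hrange : ∀ᶠ z in 𝓝 y, C.solutions (fun b => S b z) = (Ψ z).range := by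
    filter_upwards [h, hker, hdim] with z h1 h2 h3
    rw [h2]
    refine Submodule.eq_of_le_of_finrank_eq h1.2 ?_
    rw [← h2, h3, hker.self_of_nhds]
    exact (LinearMap.finrank_range_of_inj h1.1).symm
  let f : C.Data E →L[ℝ] E × (E →L[ℝ] ℝ) := LinearMap.toContinuousLinearMap C.output
  obtain ⟨k, s, T, hs, hT, hsT⟩ := exists_smooth_image hΨ f (S := D)
    (by
      filter_upwards [hrange, hD] with z h1 h2
      rw [h2, h1]
      rfl)
    -- Constancy of the rank of `D` is automatic: Lagrangian subspaces all have the dimension of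
    -- `E`.
    (by
      filter_upwards [hDL] with z h1
      rw [h1.finrank_eq, hDL.self_of_nhds.finrank_eq])
  refine ⟨⟨k, s, hs, hsT.mono fun z hz => ⟨hz.1, hz.2.1⟩⟩, fun a ha haD => ?_, fun c hc => ?_⟩
  · refine ⟨fun z => T z (a z), hT.clm_apply ha, ?_⟩
    filter_upwards [hsT, haD, hrange] with z hz h1 h2
    rw [h2]
    exact hz.2.2 _ h1
  · rw [hD.self_of_nhds] at hc
    obtain ⟨d, hd, rfl⟩ := hc
    have hd' : d ∈ (A y).ker := hker.self_of_nhds ▸ hd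
    refine ⟨fun z => Ψ z ⟨d, hd'⟩, hΨ.clm_apply (SmoothNear.const _ _), ?_, ?_⟩
    · filter_upwards [hrange] with z hz
      rw [hz]
      exact ⟨_, rfl⟩
    · exact congrArg C.output (hΨy _)

/-- A criterion for the family of outputs of a scheme to be a Dirac structure. -/
theorem flatDirac (C : Scheme) (hS : ∀ b, FlatSmoothAt (S b) y)
    (hL : ∀ b, ∀ᶠ z in 𝓝 y, IsLagrangian (S b z))
    (hdim : ∀ᶠ z in 𝓝 y, Module.finrank ℝ (C.solutions fun b => S b z) =
      Module.finrank ℝ (C.solutions fun b => S b y))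
    {D : E → Submodule ℝ (E × (E →L[ℝ] ℝ))} (hDL : ∀ᶠ z in 𝓝 y, IsLagrangian (D z))
    (hD : ∀ᶠ z in 𝓝 y, D z = (C.solutions fun b => S b z).map C.output)
    (hclosed : ∀ t t' t'' : E → C.Data E, SmoothNear t y → SmoothNear t' y → SmoothNear t'' y →
      (∀ᶠ z in 𝓝 y, t z ∈ C.solutions (fun b => S b z)) →
      (∀ᶠ z in 𝓝 y, t' z ∈ C.solutions (fun b => S b z)) →
      (∀ᶠ z in 𝓝 y, t'' z ∈ C.solutions (fun b => S b z)) →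
      courant y (fun z => (C.output (t z)).1) (fun z => (C.output (t z)).2)
        (fun z => (C.output (t' z)).1) (fun z => (C.output (t' z)).2)
        (C.output (t'' y)).1 (C.output (t'' y)).2 = 0) :
    FlatSmoothAt D y ∧ FlatDiracAt D y := by
  obtain ⟨h1, h2, h3⟩ := C.smooth_lifts hS hL hdim hDL hD
  refine ⟨h1, fun a b ha hb haD hbD => (hDL.self_of_nhds _).2 fun c hc => ?_⟩
  obtain ⟨t, ht, hta⟩ := h2 a ha haD
  obtain ⟨t', ht', htb⟩ := h2 b hb hbD
  obtain ⟨t'', ht'', hts, rfl⟩ := h3 c hc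
  have := hclosed t t' t'' ht ht' ht'' (hta.mono fun _ h => h.1) (htb.mono fun _ h => h.1) hts
  rw [pairing_flatDorfman]
  have ea : a =ᶠ[𝓝 y] fun z => C.output (t z) := hta.mono fun _ h => h.2.symm
  have eb : b =ᶠ[𝓝 y] fun z => C.output (t' z) := htb.mono fun _ h => h.2.symm
  have a1 : (fun z => (a z).1) =ᶠ[𝓝 y] fun z => (C.output (t z)).1 := ea.fun_comp Prod.fst
  have a2 : (fun z => (a z).2) =ᶠ[𝓝 y] fun z => (C.output (t z)).2 := ea.fun_comp Prod.snd
  have b1 : (fun z => (b z).1) =ᶠ[𝓝 y] fun z => (C.output (t' z)).1 := eb.fun_comp Prod.fst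
  have b2 : (fun z => (b z).2) =ᶠ[𝓝 y] fun z => (C.output (t' z)).2 := eb.fun_comp Prod.snd
  simp only [courant] at this ⊢
  rw [a1.fderiv_eq, a2.fderiv_eq, b1.fderiv_eq, b2.fderiv_eq, ea.eq_of_nhds, eb.eq_of_nhds]
  exact this

end Scheme

end FlatSchemes

/-! ### Reading families and sections in a chart -/

section Charts

variable {E : Type*} [NormedAddCommGroup E] [NormedSpace ℝ E]
  {M : Type*} [TopologicalSpace M] [ChartedSpace E M]

/-- The derivative of the chart at `x₀`, as a linear endomorphism of the model space. -/
def chartD (x₀ x : M) : E →L[ℝ] E := mfderiv 𝓘(ℝ, E) 𝓘(ℝ, E) (extChartAt 𝓘(ℝ, E) x₀) x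

/-- The derivative of the inverse of the chart at `x₀`, as a linear endomorphism of the model
space. -/
def chartDSymm (x₀ : M) (y : E) : E →L[ℝ] E :=
  mfderiv 𝓘(ℝ, E) 𝓘(ℝ, E) (extChartAt 𝓘(ℝ, E) x₀).symm y

/-- The fibre over a point of a Lagrangian family, in the model space. -/
def modelFiber (L : LagrangianFamily E M) (x : M) : Submodule ℝ (E × (E →L[ℝ] ℝ)) := L.fiber x

theorem isLagrangian_modelFiber (L : LagrangianFamily E M) (x : M) :
    IsLagrangian (modelFiber L x) := L.isLagrangian x

/-- A Lagrangian family, read in the chart at `x₀`. -/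
def chartFamily (L : LagrangianFamily E M) (x₀ : M) (y : E) : Submodule ℝ (E × (E →L[ℝ] ℝ)) where
  carrier := {c : E × (E →L[ℝ] ℝ) |
    (chartDSymm x₀ y c.1, c.2.comp (chartD x₀ ((extChartAt 𝓘(ℝ, E) x₀).symm y))) ∈
    modelFiber L ((extChartAt 𝓘(ℝ, E) x₀).symm y)}
  zero_mem' := by
    rw [mem_ofPred_eq, Prod.fst_zero, map_zero, Prod.snd_zero, ContinuousLinearMap.zero_comp]
    exact (modelFiber L _).zero_mem
  add_mem' ha hb := by simpa using (modelFiber L _).add_mem ha hb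
  smul_mem' t a ha := by simpa using (modelFiber L _).smul_mem t ha

/-- A section of the generalized tangent bundle, read in the chart at `x₀`. -/
def chartSection (x₀ : M) (a : ∀ x : M, GTangentSpace E x) (y : E) : E × (E →L[ℝ] ℝ) :=
  (chartField (E := E) x₀ (fun x => (a x).1) y, chartForm (E := E) x₀ (fun x => (a x).2) y)

/-- The section of the generalized tangent bundle given in the chart at `x₀` by `s`. -/
def ofChartSection (x₀ : M) (s : E → E × (E →L[ℝ] ℝ)) (x : M) : GTangentSpace E x :=
  (chartDSymm (E := E) x₀ (extChartAt 𝓘(ℝ, E) x₀ x) (s (extChartAt 𝓘(ℝ, E) x₀ x)).1,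
    (s (extChartAt 𝓘(ℝ, E) x₀ x)).2.comp (chartD (E := E) x₀ x))

variable [IsManifold 𝓘(ℝ, E) ∞ M] {x₀ x : M} {y : E}

theorem chartD_comp_chartDSymm (hy : y ∈ (extChartAt 𝓘(ℝ, E) x₀).target) :
    (chartD x₀ ((extChartAt 𝓘(ℝ, E) x₀).symm y)).comp (chartDSymm x₀ y) =
      ContinuousLinearMap.id ℝ E := by
  have : IsManifold 𝓘(ℝ, E) 1 M := .of_le (n := ∞) (by simp)
  have h := mfderiv_extChartAt_comp_mfderivWithin_extChartAt_symm hy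
  rw [ModelWithCorners.range_eq_univ, mfderivWithin_univ] at h
  exact h

theorem chartDSymm_comp_chartD (hy : y ∈ (extChartAt 𝓘(ℝ, E) x₀).target) :
    (chartDSymm x₀ y).comp (chartD x₀ ((extChartAt 𝓘(ℝ, E) x₀).symm y)) =
      ContinuousLinearMap.id ℝ E := by
  have : IsManifold 𝓘(ℝ, E) 1 M := .of_le (n := ∞) (by simp)
  have h := mfderivWithin_extChartAt_symm_comp_mfderiv_extChartAt hy
  rw [ModelWithCorners.range_eq_univ, mfderivWithin_univ] at h
  exact h

/-- The derivative of the chart at `x₀` as a linear automorphism of the model space. -/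
def chartDEquiv (hy : y ∈ (extChartAt 𝓘(ℝ, E) x₀).target) : E ≃L[ℝ] E :=
  ContinuousLinearEquiv.equivOfInverse (chartD x₀ ((extChartAt 𝓘(ℝ, E) x₀).symm y))
    (chartDSymm x₀ y)
    (fun v => congrArg (fun f : E →L[ℝ] E => f v) (chartDSymm_comp_chartD hy))
    (fun v => congrArg (fun f : E →L[ℝ] E => f v) (chartD_comp_chartDSymm hy))

theorem mem_chartFamily_congr (L : LagrangianFamily E M)
    (hy : y ∈ (extChartAt 𝓘(ℝ, E) x₀).target) (v : E) (ξ : E →L[ℝ] ℝ) :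
    (chartDEquiv hy v, ξ.comp ((chartDEquiv hy).symm : E →L[ℝ] E)) ∈ chartFamily L x₀ y ↔
      (v, ξ) ∈ modelFiber L ((extChartAt 𝓘(ℝ, E) x₀).symm y) := by
  have h1 : chartDSymm x₀ y (chartDEquiv hy v) = v :=
    congrArg (fun f : E →L[ℝ] E => f v) (chartDSymm_comp_chartD hy)
  have h2 : (ξ.comp ((chartDEquiv hy).symm : E →L[ℝ] E)).comp
      (chartD x₀ ((extChartAt 𝓘(ℝ, E) x₀).symm y)) = ξ := by
    change (ξ.comp (chartDSymm x₀ y)).comp _ = _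
    rw [ContinuousLinearMap.comp_assoc, chartDSymm_comp_chartD hy, ContinuousLinearMap.comp_id]
  change (_, _) ∈ modelFiber L _ ↔ _
  rw [h1, h2]

theorem chartField_eq (u : ∀ x : M, TangentSpace 𝓘(ℝ, E) x)
    (hy : y ∈ (extChartAt 𝓘(ℝ, E) x₀).target) :
    chartField (E := E) x₀ u y = chartD (E := E) x₀ ((extChartAt 𝓘(ℝ, E) x₀).symm y)
      (u ((extChartAt 𝓘(ℝ, E) x₀).symm y)) := by
  have h : (chartDSymm x₀ y).inverse = chartD x₀ ((extChartAt 𝓘(ℝ, E) x₀).symm y) :=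
    ContinuousLinearMap.inverse_eq (chartDSymm_comp_chartD hy) (chartD_comp_chartDSymm hy)
  exact congrArg (fun f : E →L[ℝ] E => f (u ((extChartAt 𝓘(ℝ, E) x₀).symm y))) h

theorem chartSection_mem_iff (L : LagrangianFamily E M) (a : ∀ x : M, GTangentSpace E x)
    (hy : y ∈ (extChartAt 𝓘(ℝ, E) x₀).target) :
    chartSection x₀ a y ∈ chartFamily L x₀ y ↔
      a ((extChartAt 𝓘(ℝ, E) x₀).symm y) ∈ L.fiber ((extChartAt 𝓘(ℝ, E) x₀).symm y) := by
  have h := mem_chartFamily_congr L hy (a ((extChartAt 𝓘(ℝ, E) x₀).symm y)).1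
    (a ((extChartAt 𝓘(ℝ, E) x₀).symm y)).2
  have h2 : chartSection x₀ a y = (chartDEquiv hy (a ((extChartAt 𝓘(ℝ, E) x₀).symm y)).1,
      ((a ((extChartAt 𝓘(ℝ, E) x₀).symm y)).2 : E →L[ℝ] ℝ).comp
        ((chartDEquiv hy).symm : E →L[ℝ] E)) :=
    Prod.ext (chartField_eq (fun x => (a x).1) hy) rfl
  rw [h2]
  exact h

theorem chartSection_ofChartSection (s : E → E × (E →L[ℝ] ℝ))
    (hy : y ∈ (extChartAt 𝓘(ℝ, E) x₀).target) :
    chartSection x₀ (ofChartSection x₀ s) y = s y := by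
  have hr := (extChartAt 𝓘(ℝ, E) x₀).right_inv hy
  refine Prod.ext ?_ ?_
  · refine (chartField_eq (fun x => (ofChartSection x₀ s x).1) hy).trans ?_
    change chartD x₀ _ (chartDSymm x₀ (extChartAt 𝓘(ℝ, E) x₀ _) (s (extChartAt 𝓘(ℝ, E) x₀ _)).1) = _
    rw [hr]
    exact congrArg (fun f : E →L[ℝ] E => f (s y).1) (chartD_comp_chartDSymm hy)
  · change ((s (extChartAt 𝓘(ℝ, E) x₀ _)).2.comp (chartD x₀ _)).comp (chartDSymm x₀ y) = _
    rw [hr, ContinuousLinearMap.comp_assoc, chartD_comp_chartDSymm hy,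
      ContinuousLinearMap.comp_id]

theorem isLagrangian_chartFamily (L : LagrangianFamily E M)
    (hy : y ∈ (extChartAt 𝓘(ℝ, E) x₀).target) : IsLagrangian (chartFamily L x₀ y) := by
  have hsurj : ∀ b : E × (E →L[ℝ] ℝ), ∃ (v : E) (ξ : E →L[ℝ] ℝ),
      b = (chartDEquiv hy v, ξ.comp ((chartDEquiv hy).symm : E →L[ℝ] E)) := fun b =>
    ⟨(chartDEquiv hy).symm b.1, b.2.comp (chartDEquiv hy : E →L[ℝ] E),
      Prod.ext (by simp) (by ext; simp)⟩
  intro a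
  obtain ⟨v, ξ, rfl⟩ := hsurj a
  rw [mem_chartFamily_congr, isLagrangian_modelFiber L _ (v, ξ)]
  constructor
  · intro h b hb
    obtain ⟨v', ξ', rfl⟩ := hsurj b
    rw [mem_chartFamily_congr] at hb
    simpa [pairing] using h _ hb
  · rintro h ⟨v', ξ'⟩ hb
    simpa [pairing] using h _ ((mem_chartFamily_congr L hy v' ξ').2 hb)

theorem contMDiffOn_field_iff (u : ∀ x : M, TangentSpace 𝓘(ℝ, E) x) {V : Set M} (hV : IsOpen V)
    (hVs : V ⊆ (extChartAt 𝓘(ℝ, E) x₀).source) :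
    ContMDiffOn 𝓘(ℝ, E) (𝓘(ℝ, E).prod 𝓘(ℝ, E)) ∞
      (fun x => TotalSpace.mk' E (E := (TangentSpace 𝓘(ℝ, E) : M → Type _)) x (u x)) V ↔
    ContMDiffOn 𝓘(ℝ, E) 𝓘(ℝ, E) ∞ (fun x => chartD x₀ x (u x)) V := by
  have : IsManifold 𝓘(ℝ, E) 1 M := .of_le (n := ∞) (by simp)
  rw [extChartAt_source] at hVs
  rw [(trivializationAt E (TangentSpace 𝓘(ℝ, E) : M → Type _) x₀).contMDiffOn_section_iff hV
    (by simpa using hVs)]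
  refine contMDiffOn_congr fun x hx => ?_
  have h := TangentBundle.continuousLinearMapAt_trivializationAt (I := 𝓘(ℝ, E)) (hVs hx)
  have h2 := congrArg (fun f : E →L[ℝ] E => f (u x)) h
  refine Eq.trans ?_ h2
  exact (Trivialization.continuousLinearMapAt_apply_of_mem (R := ℝ) _
    (by simpa using hVs hx) _).symm

theorem contMDiffOn_form_iff (ξ : ∀ x : M, TangentSpace 𝓘(ℝ, E) x →L[ℝ] ℝ) {V : Set M}
    (hV : IsOpen V) (hVs : V ⊆ (extChartAt 𝓘(ℝ, E) x₀).source) :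
    ContMDiffOn 𝓘(ℝ, E) (𝓘(ℝ, E).prod 𝓘(ℝ, E →L[ℝ] ℝ)) ∞
      (fun x => TotalSpace.mk' (E →L[ℝ] ℝ)
        (E := fun y : M => TangentSpace 𝓘(ℝ, E) y →L[ℝ] Bundle.Trivial M ℝ y) x (ξ x)) V ↔
    ContMDiffOn 𝓘(ℝ, E) 𝓘(ℝ, E →L[ℝ] ℝ) ∞
      (fun x => (ξ x : E →L[ℝ] ℝ).comp (chartDSymm x₀ (extChartAt 𝓘(ℝ, E) x₀ x))) V := by
  have : IsManifold 𝓘(ℝ, E) 1 M := .of_le (n := ∞) (by simp)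
  rw [extChartAt_source] at hVs
  rw [(trivializationAt (E →L[ℝ] ℝ)
    (fun y : M => TangentSpace 𝓘(ℝ, E) y →L[ℝ] Bundle.Trivial M ℝ y) x₀).contMDiffOn_section_iff hV
    (by simpa using hVs)]
  refine contMDiffOn_congr fun x hx => ?_
  have h := TangentBundle.symmL_trivializationAt (I := 𝓘(ℝ, E)) (hVs hx)
  rw [ModelWithCorners.range_eq_univ, mfderivWithin_univ] at h
  have h2 := congrArg (fun f : E →L[ℝ] E => (ξ x : E →L[ℝ] ℝ).comp f) h
  refine Eq.trans ?_ h2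
  rw [hom_trivializationAt_apply]
  ext v
  simp [ContinuousLinearMap.inCoordinates]

omit [IsManifold 𝓘(ℝ, E) ∞ M] in
theorem eventually_chart {V : Set M} (hV : IsOpen V) (hx : x ∈ V)
    (hxs : x ∈ (extChartAt 𝓘(ℝ, E) x₀).source) :
    ∀ᶠ z in 𝓝 (extChartAt 𝓘(ℝ, E) x₀ x), z ∈ (extChartAt 𝓘(ℝ, E) x₀).target ∧
      (extChartAt 𝓘(ℝ, E) x₀).symm z ∈ V := by
  have h1 := (isOpen_extChartAt_target (I := 𝓘(ℝ, E)) x₀).mem_nhds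
    ((extChartAt 𝓘(ℝ, E) x₀).map_source hxs)
  have h2 := (continuousAt_extChartAt_symm'' (I := 𝓘(ℝ, E))
    ((extChartAt 𝓘(ℝ, E) x₀).map_source hxs)).eventually
    (p := fun x => x ∈ V) (by
      rw [(extChartAt 𝓘(ℝ, E) x₀).left_inv hxs]
      exact hV.mem_nhds hx)
  filter_upwards [h1, h2] with z h3 h4 using ⟨h3, h4⟩

theorem smoothNear_comp_chart {F : Type*} [NormedAddCommGroup F] [NormedSpace ℝ F] {f : M → F}
    {g : E → F} {V : Set M} (hV : IsOpen V) (hx : x ∈ V)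
    (hxs : x ∈ (extChartAt 𝓘(ℝ, E) x₀).source) (hf : ContMDiffOn 𝓘(ℝ, E) 𝓘(ℝ, F) ∞ f V)
    (hg : ∀ z ∈ (extChartAt 𝓘(ℝ, E) x₀).target, f ((extChartAt 𝓘(ℝ, E) x₀).symm z) = g z) :
    SmoothNear g (extChartAt 𝓘(ℝ, E) x₀ x) := by
  filter_upwards [eventually_chart hV hx hxs] with z hz
  have ht := (isOpen_extChartAt_target (I := 𝓘(ℝ, E)) x₀).mem_nhds hz.1
  have h1 : ContMDiffAt 𝓘(ℝ, E) 𝓘(ℝ, E) ∞ (extChartAt 𝓘(ℝ, E) x₀).symm z :=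
    (contMDiffOn_extChartAt_symm x₀).contMDiffAt ht
  have h2 := ContMDiffAt.comp z (hf.contMDiffAt (hV.mem_nhds hz.2)) h1
  rw [contMDiffAt_iff_contDiffAt] at h2
  refine h2.congr_of_eventuallyEq ?_
  filter_upwards [ht] with w hw using (hg w hw).symm

theorem smoothNear_chartSection {a : ∀ x : M, GTangentSpace E x} {V : Set M} (hV : IsOpen V)
    (ha : IsSmoothSectionOn a V) (hx : x ∈ V) (hxs : x ∈ (extChartAt 𝓘(ℝ, E) x₀).source) :
    SmoothNear (chartSection x₀ a) (extChartAt 𝓘(ℝ, E) x₀ x) := by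
  have hV' := hV.inter (isOpen_extChartAt_source (I := 𝓘(ℝ, E)) x₀)
  have h1 := (contMDiffOn_field_iff (x₀ := x₀) _ hV' inter_subset_right).1
    (ha.1.mono inter_subset_left)
  have h2 := (contMDiffOn_form_iff (x₀ := x₀) _ hV' inter_subset_right).1
    (ha.2.mono inter_subset_left)
  have h3 := smoothNear_comp_chart (x₀ := x₀) (g := fun z => (chartSection x₀ a z).1)
    hV' ⟨hx, hxs⟩ hxs h1
    (fun z hz => (chartField_eq (fun x => (a x).1) hz).symm)
  have h4 := smoothNear_comp_chart (x₀ := x₀) (g := fun z => (chartSection x₀ a z).2)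
    hV' ⟨hx, hxs⟩ hxs h2
    (fun z hz => by
      rw [(extChartAt 𝓘(ℝ, E) x₀).right_inv hz]
      rfl)
  filter_upwards [h3, h4] with z h5 h6 using h5.prodMk h6

theorem isSmoothSectionOn_ofChartSection {s : E → E × (E →L[ℝ] ℝ)} {V : Set M} (hV : IsOpen V)
    (hVs : V ⊆ (extChartAt 𝓘(ℝ, E) x₀).source)
    (hs : ∀ x ∈ V, ContDiffAt ℝ ∞ s (extChartAt 𝓘(ℝ, E) x₀ x)) :
    IsSmoothSectionOn (ofChartSection x₀ s) V := by
  have hchart : ∀ x ∈ V, ContMDiffAt 𝓘(ℝ, E) 𝓘(ℝ, E) ∞ (extChartAt 𝓘(ℝ, E) x₀) x := fun x hx =>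
    contMDiffAt_extChartAt' (by simpa using hVs hx)
  constructor
  · rw [contMDiffOn_field_iff (x₀ := x₀) _ hV hVs]
    have h : ContMDiffOn 𝓘(ℝ, E) 𝓘(ℝ, E) ∞ (fun x => (s (extChartAt 𝓘(ℝ, E) x₀ x)).1) V :=
      fun x hx => (ContMDiffAt.comp x (hs x hx).fst.contMDiffAt (hchart x hx)).contMDiffWithinAt
    refine h.congr fun x hx => ?_
    have h1 := chartD_comp_chartDSymm ((extChartAt 𝓘(ℝ, E) x₀).map_source (hVs hx))
    rw [(extChartAt 𝓘(ℝ, E) x₀).left_inv (hVs hx)] at h1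
    exact congrArg (fun f : E →L[ℝ] E => f (s (extChartAt 𝓘(ℝ, E) x₀ x)).1) h1
  · rw [contMDiffOn_form_iff (x₀ := x₀) _ hV hVs]
    have h : ContMDiffOn 𝓘(ℝ, E) 𝓘(ℝ, E →L[ℝ] ℝ) ∞ (fun x => (s (extChartAt 𝓘(ℝ, E) x₀ x)).2) V :=
      fun x hx => (ContMDiffAt.comp x (hs x hx).snd.contMDiffAt (hchart x hx)).contMDiffWithinAt
    refine h.congr fun x hx => ?_
    have h1 := chartD_comp_chartDSymm ((extChartAt 𝓘(ℝ, E) x₀).map_source (hVs hx))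
    rw [(extChartAt 𝓘(ℝ, E) x₀).left_inv (hVs hx)] at h1
    exact congrArg (fun f : E →L[ℝ] E => (s (extChartAt 𝓘(ℝ, E) x₀ x)).2.comp f) h1

/-- Both components of `dorfman` at `x` are by definition computed in the chart at `x`, so no change
of charts enters. -/
theorem dorfman_mem_iff (L : LagrangianFamily E M) (a b : ∀ x : M, GTangentSpace E x) (x : M) :
    dorfman a b x ∈ L.fiber x ↔ flatDorfman (chartSection x a) (chartSection x b)
      (extChartAt 𝓘(ℝ, E) x x) ∈ chartFamily L x (extChartAt 𝓘(ℝ, E) x x) := by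
  have hx := mem_extChartAt_source (I := 𝓘(ℝ, E)) x
  have hy := (extChartAt 𝓘(ℝ, E) x).map_source hx
  have e1 := chartD_comp_chartDSymm hy
  have e2 := chartDSymm_comp_chartD hy
  rw [(extChartAt 𝓘(ℝ, E) x).left_inv hx] at e1 e2
  have hinv : (chartD x x).inverse = chartDSymm x (extChartAt 𝓘(ℝ, E) x x) :=
    ContinuousLinearMap.inverse_eq e1 e2
  have hb : (VectorField.mlieBracket 𝓘(ℝ, E) (fun y => (a y).1) (fun y => (b y).1) x : E) =
      chartDSymm x (extChartAt 𝓘(ℝ, E) x x)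
        (flatDorfman (chartSection x a) (chartSection x b) (extChartAt 𝓘(ℝ, E) x x)).1 := by
    rw [← hinv]
    simp only [VectorField.mlieBracket, VectorField.mlieBracketWithin,
      ModelWithCorners.range_eq_univ, VectorField.mpullbackWithin_univ, preimage_univ, inter_univ]
    have h := congrFun (VectorField.lieBracketWithin_univ (𝕜 := ℝ)
      (V := fun z => (chartSection x a z).1) (W := fun z => (chartSection x b z).1))
      (extChartAt 𝓘(ℝ, E) x x)
    exact congrArg (fun v : E => (chartD x x).inverse v) h
  -- The fibre depends on the base point, and the inverse chart returns `x` only propositionally;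
  -- generalizing over x' carries membership across that equality.
  have key : ∀ x' : M, x' = x →
      ((dorfman a b x ∈ L.fiber x) ↔
      ((chartDSymm x (extChartAt 𝓘(ℝ, E) x x)
        (flatDorfman (chartSection x a) (chartSection x b) (extChartAt 𝓘(ℝ, E) x x)).1,
        (flatDorfman (chartSection x a) (chartSection x b) (extChartAt 𝓘(ℝ, E) x x)).2.comp
          (chartD x x')) ∈ modelFiber L x')) := by
    rintro x' rfl
    rw [← hb]
    rfl
  exact key _ ((extChartAt 𝓘(ℝ, E) x).left_inv hx)

end Charts

/-! ### From local identities to involutivity on the manifold -/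

section Transfer

/-- An upper semicontinuous function with values in `ℕ` is locally constant on a dense open set. -/
theorem isOpen_dense_locally_constant {X : Type*} [TopologicalSpace X] {f : X → ℕ}
    (hf : ∀ x, ∀ᶠ x' in 𝓝 x, f x' ≤ f x) :
    IsOpen {x | ∀ᶠ x' in 𝓝 x, f x' = f x} ∧ Dense {x | ∀ᶠ x' in 𝓝 x, f x' = f x} := by
  constructor
  · rw [isOpen_iff_eventually]
    intro x hx
    filter_upwards [eventually_eventually_nhds.2 hx] with x' hx'
    have h := hx'.self_of_nhds
    change ∀ᶠ x'' in 𝓝 x', f x'' = f x'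
    filter_upwards [hx'] with x'' h' using h'.trans h.symm
  · rw [dense_iff_inter_open]
    intro U hU hne
    -- At a minimum of `f` over `U`, semicontinuity bounds nearby values above and minimality bounds
    -- them below.
    obtain ⟨x, hx, hmin⟩ := (measure f).wf.has_min U hne
    refine ⟨x, hx, ?_⟩
    filter_upwards [hU.mem_nhds hx, hf x] with x' h1 h2
    exact le_antisymm h2 (not_lt.1 (hmin x' h1))

/-- The action of a linear isomorphism on `V ⊕ V*`. -/
def pairCongr {V W : Type*} [AddCommGroup V] [Module ℝ V] [TopologicalSpace V]
    [IsTopologicalAddGroup V] [ContinuousSMul ℝ V] [AddCommGroup W] [Module ℝ W]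
    [TopologicalSpace W] [IsTopologicalAddGroup W] [ContinuousSMul ℝ W] (g : V ≃L[ℝ] W) :
    (V × (V →L[ℝ] ℝ)) ≃ₗ[ℝ] W × (W →L[ℝ] ℝ) where
  toFun c := (g c.1, c.2.comp (g.symm : W →L[ℝ] V))
  map_add' c c' := by ext <;> simp
  map_smul' t c := by ext <;> simp
  invFun c := (g.symm c.1, c.2.comp (g : V →L[ℝ] W))
  left_inv c := by ext <;> simp
  right_inv c := by ext <;> simp

theorem cotangentProd_map_pairCongr {V W : Type*} [AddCommGroup V] [Module ℝ V]
    [TopologicalSpace V] [IsTopologicalAddGroup V] [ContinuousSMul ℝ V] [AddCommGroup W]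
    [Module ℝ W] [TopologicalSpace W] [IsTopologicalAddGroup W] [ContinuousSMul ℝ W]
    (g : V ≃L[ℝ] W) (L R : Submodule ℝ (V × (V →L[ℝ] ℝ))) :
    cotangentProd (L.map (pairCongr g : _ →ₗ[ℝ] W × (W →L[ℝ] ℝ)))
      (R.map (pairCongr g : _ →ₗ[ℝ] W × (W →L[ℝ] ℝ))) =
      (cotangentProd L R).map (pairCongr g : _ →ₗ[ℝ] W × (W →L[ℝ] ℝ)) := by
  ext c
  constructor
  · rintro ⟨_, ⟨⟨u, ξ⟩, ha, rfl⟩, _, ⟨⟨v, η⟩, hb, rfl⟩, h, rfl⟩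
    have h' : ξ = η := by
      have h1 : ξ.comp (g.symm : W →L[ℝ] V) = η.comp (g.symm : W →L[ℝ] V) := h
      have h2 := congrArg (fun f : W →L[ℝ] ℝ => f.comp (g : V →L[ℝ] W)) h1
      ext w
      simpa using congrArg (fun f : V →L[ℝ] ℝ => f w) h2
    exact ⟨(u + v, ξ), ⟨_, ha, _, hb, h', rfl⟩, Prod.ext (map_add g u v) rfl⟩
  · rintro ⟨_, ⟨⟨u, ξ⟩, ha, ⟨v, η⟩, hb, h, rfl⟩, rfl⟩
    obtain rfl : ξ = η := h
    exact ⟨_, ⟨_, ha, rfl⟩, _, ⟨_, hb, rfl⟩, rfl, Prod.ext (map_add g u v) rfl⟩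

theorem frame_map_iff {V W ι : Type*} [AddCommGroup V] [Module ℝ V] [AddCommGroup W] [Module ℝ W]
    (τ : V ≃ₗ[ℝ] W) (s : ι → V) (L : Submodule ℝ V) :
    (LinearIndependent ℝ (τ ∘ s) ∧ Submodule.span ℝ (Set.range (τ ∘ s)) =
      L.map (τ : V →ₗ[ℝ] W)) ↔
    LinearIndependent ℝ s ∧ Submodule.span ℝ (Set.range s) = L := by
  rw [Set.range_comp, ← LinearEquiv.coe_coe, ← Submodule.map_span,
    (Submodule.map_injective_of_injective τ.injective).eq_iff]
  exact and_congr_left fun _ => LinearMap.linearIndependent_iff (τ : V →ₗ[ℝ] W)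
    (LinearMap.ker_eq_bot.2 τ.injective)

theorem FlatDiracAt.congr {E : Type*} [NormedAddCommGroup E] [NormedSpace ℝ E]
    {S S' : E → Submodule ℝ (E × (E →L[ℝ] ℝ))} {y : E} (h : FlatDiracAt S y)
    (hS : ∀ᶠ z in 𝓝 y, S z = S' z) : FlatDiracAt S' y := by
  intro a b ha hb haS hbS
  rw [← hS.self_of_nhds]
  refine h a b ha hb ?_ ?_
  · filter_upwards [hS, haS] with z h1 h2 using h1 ▸ h2
  · filter_upwards [hS, hbS] with z h1 h2 using h1 ▸ h2

variable {E : Type*} [NormedAddCommGroup E] [NormedSpace ℝ E]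
  {M : Type*} [TopologicalSpace M] [ChartedSpace E M] [IsManifold 𝓘(ℝ, E) ∞ M] {x₀ : M} {y : E}

theorem chartFamily_eq_map (L : LagrangianFamily E M)
    (hy : y ∈ (extChartAt 𝓘(ℝ, E) x₀).target) :
    chartFamily L x₀ y = (modelFiber L ((extChartAt 𝓘(ℝ, E) x₀).symm y)).map
      (pairCongr (chartDEquiv hy) : _ →ₗ[ℝ] E × (E →L[ℝ] ℝ)) := by
  ext c
  obtain ⟨⟨v, ξ⟩, rfl⟩ := (pairCongr (chartDEquiv hy)).surjective c
  refine (mem_chartFamily_congr L hy v ξ).trans ⟨fun h => ⟨_, h, rfl⟩, ?_⟩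
  rintro ⟨c, hc, h⟩
  rwa [← (pairCongr (chartDEquiv hy)).injective h]

theorem chartSection_frame_iff (L : LagrangianFamily E M) {k : ℕ}
    (s : Fin k → ∀ x : M, GTangentSpace E x) (hy : y ∈ (extChartAt 𝓘(ℝ, E) x₀).target) :
    (LinearIndependent ℝ (fun i => chartSection x₀ (s i) y) ∧
      Submodule.span ℝ (Set.range fun i => chartSection x₀ (s i) y) = chartFamily L x₀ y) ↔
    (LinearIndependent ℝ (fun i => s i ((extChartAt 𝓘(ℝ, E) x₀).symm y)) ∧
      Submodule.span ℝ (Set.range fun i => s i ((extChartAt 𝓘(ℝ, E) x₀).symm y)) =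
        L.fiber ((extChartAt 𝓘(ℝ, E) x₀).symm y)) := by
  let s' : Fin k → E × (E →L[ℝ] ℝ) := fun i => s i ((extChartAt 𝓘(ℝ, E) x₀).symm y)
  let τ := pairCongr (chartDEquiv hy)
  have hs : (fun i => chartSection x₀ (s i) y) = τ ∘ s' := funext fun i =>
    Prod.ext (chartField_eq (fun x => (s i x).1) hy) rfl
  change _ ↔ LinearIndependent ℝ s' ∧ Submodule.span ℝ (Set.range s') = modelFiber L _
  rw [hs, chartFamily_eq_map L hy]
  exact frame_map_iff τ s' _

omit [IsManifold 𝓘(ℝ, E) ∞ M] in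
/-- Open neighbourhoods of `x₀` on which a property holds in the chart at `x₀`. -/
theorem exists_chart_nhds {p : E → Prop} {U : Set M} (hU : IsOpen U) (hx₀ : x₀ ∈ U)
    (hp : ∀ᶠ z in 𝓝 (extChartAt 𝓘(ℝ, E) x₀ x₀), p z) :
    ∃ V : Set M, IsOpen V ∧ x₀ ∈ V ∧ V ⊆ U ∧ V ⊆ (extChartAt 𝓘(ℝ, E) x₀).source ∧
      ∀ x ∈ V, p (extChartAt 𝓘(ℝ, E) x₀ x) := by
  obtain ⟨W, hW, hWo, hyW⟩ := eventually_nhds_iff.1 hp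
  refine ⟨((extChartAt 𝓘(ℝ, E) x₀).source ∩ extChartAt 𝓘(ℝ, E) x₀ ⁻¹' W) ∩ U,
    ((continuousOn_extChartAt x₀).isOpen_inter_preimage (isOpen_extChartAt_source x₀) hWo).inter hU,
    ⟨⟨mem_extChartAt_source x₀, hyW⟩, hx₀⟩, inter_subset_right,
    fun x hx => hx.1.1, fun x hx => hW _ hx.1.2⟩

/-- Dirac structures are characterized by their local expressions. -/
theorem isDiracOn_iff (L : LagrangianFamily E M) {U : Set M} (hU : IsOpen U) :
    L.IsDiracOn U ↔ ∀ x ∈ U, FlatSmoothAt (chartFamily L x) (extChartAt 𝓘(ℝ, E) x x) ∧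
      FlatDiracAt (chartFamily L x) (extChartAt 𝓘(ℝ, E) x x) := by
  constructor
  · rintro ⟨hs, hd⟩ x hx
    constructor
    · obtain ⟨V, hV, hxV, -, k, s, hsm, hfr⟩ := hs x hx
      refine ⟨k, fun i => chartSection x (s i), fun i =>
        smoothNear_chartSection hV (hsm i) hxV (mem_extChartAt_source x), ?_⟩
      filter_upwards [eventually_chart hV hxV (mem_extChartAt_source x)] with z hz
      exact (chartSection_frame_iff L s hz.1).2 (hfr _ hz.2)
    · intro a b ha hb haL hbL
      obtain ⟨V, hV, hxV, hVU, hVs, hp⟩ := exists_chart_nhds hU hx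
        ((ha.and hb).and (haL.and hbL))
      have hsec : ∀ c : E → E × (E →L[ℝ] ℝ),
          (∀ x' ∈ V, ContDiffAt ℝ ∞ c (extChartAt 𝓘(ℝ, E) x x')) →
          (∀ x' ∈ V, c (extChartAt 𝓘(ℝ, E) x x') ∈
            chartFamily L x (extChartAt 𝓘(ℝ, E) x x')) →
          L.IsSectionOn (ofChartSection x c) V := by
        intro c h1 h2
        refine ⟨isSmoothSectionOn_ofChartSection hV hVs h1, fun x' hx' => ?_⟩
        have hz := (extChartAt 𝓘(ℝ, E) x).map_source (hVs hx')
        have h3 := h2 x' hx'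
        rw [← chartSection_ofChartSection c hz, chartSection_mem_iff L _ hz] at h3
        have key : ∀ x'' : M, x'' = x' → ofChartSection x c x'' ∈ L.fiber x'' →
            ofChartSection x c x' ∈ L.fiber x' := by
          rintro _ rfl h
          exact h
        exact key _ ((extChartAt 𝓘(ℝ, E) x).left_inv (hVs hx')) h3
      have h := hd V hV hVU _ _ (hsec a (fun x' hx' => (hp x' hx').1.1)
        (fun x' hx' => (hp x' hx').2.1)) (hsec b (fun x' hx' => (hp x' hx').1.2)
        (fun x' hx' => (hp x' hx').2.2)) x hxV
      rw [dorfman_mem_iff] at h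
      -- The section rebuilt on `M` agrees with `c` only on the chart target, which suffices since
      -- the bracket depends on germs.
      have heq : ∀ c : E → E × (E →L[ℝ] ℝ), chartSection x (ofChartSection x c)
          =ᶠ[𝓝 (extChartAt 𝓘(ℝ, E) x x)] c := fun c => by
        filter_upwards [(isOpen_extChartAt_target (I := 𝓘(ℝ, E)) x).mem_nhds
          (mem_extChartAt_target x)] with z hz using chartSection_ofChartSection c hz
      have hpair : flatDorfman (chartSection x (ofChartSection x a))
          (chartSection x (ofChartSection x b)) (extChartAt 𝓘(ℝ, E) x x) =
          flatDorfman a b (extChartAt 𝓘(ℝ, E) x x) := by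
        have a1 := (heq a).fun_comp Prod.fst
        have a2 := (heq a).fun_comp Prod.snd
        have b1 := (heq b).fun_comp Prod.fst
        have b2 := (heq b).fun_comp Prod.snd
        simp only [Function.comp_def] at a1 a2 b1 b2
        simp only [flatDorfman, VectorField.lieBracket, lieDerivFormFlat, contractExtDerivFlat,
          a1.fderiv_eq, a2.fderiv_eq, b1.fderiv_eq, b2.fderiv_eq, (heq a).eq_of_nhds,
          (heq b).eq_of_nhds]
      rwa [hpair] at h
  · intro h
    constructor
    · intro x hx
      obtain ⟨k, s, hs, hfr⟩ := (h x hx).1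
      obtain ⟨V, hV, hxV, hVU, hVs, hp⟩ := exists_chart_nhds hU hx
        ((eventually_all.2 hs).and hfr)
      refine ⟨V, hV, hxV, hVU, k, fun i => ofChartSection x (s i), fun i =>
        isSmoothSectionOn_ofChartSection hV hVs fun x' hx' => (hp x' hx').1 i, fun x' hx' => ?_⟩
      have h2 := (hp x' hx').2
      obtain ⟨z, hz, rfl⟩ : ∃ z ∈ (extChartAt 𝓘(ℝ, E) x).target,
          (extChartAt 𝓘(ℝ, E) x).symm z = x' :=
        ⟨_, (extChartAt 𝓘(ℝ, E) x).map_source (hVs hx'),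
          (extChartAt 𝓘(ℝ, E) x).left_inv (hVs hx')⟩
      rw [(extChartAt 𝓘(ℝ, E) x).right_inv hz] at h2
      refine (chartSection_frame_iff L _ hz).1 ?_
      simpa only [chartSection_ofChartSection _ hz] using h2
    · intro V hV hVU a b ha hb x hx
      rw [dorfman_mem_iff]
      have hxs := mem_extChartAt_source (I := 𝓘(ℝ, E)) x
      have hmem : ∀ a, L.IsSectionOn a V →
          ∀ᶠ z in 𝓝 (extChartAt 𝓘(ℝ, E) x x), chartSection x a z ∈ chartFamily L x z := by
        intro a ha
        filter_upwards [eventually_chart hV hx hxs] with z hz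
        exact (chartSection_mem_iff L a hz.1).2 (ha.2 _ hz.2)
      exact (h x (hVU hx)).2 _ _ (smoothNear_chartSection hV ha.1 hx hxs)
        (smoothNear_chartSection hV hb.1 hx hxs) (hmem a ha) (hmem b hb)

theorem eventually_isLagrangian_chartFamily (L : LagrangianFamily E M) (x : M) :
    ∀ᶠ z in 𝓝 (extChartAt 𝓘(ℝ, E) x x), IsLagrangian (chartFamily L x z) := by
  filter_upwards [(isOpen_extChartAt_target (I := 𝓘(ℝ, E)) x).mem_nhds
    (mem_extChartAt_target x)] with z hz using isLagrangian_chartFamily L hz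

variable [FiniteDimensional ℝ E]

theorem concurAt_chartFamily {L R : LagrangianFamily E M} (hL : L.IsDirac) (hR : R.IsDirac)
    {U : Set M} (hU : IsOpen U) (hLR : (L.cotangentProd R).IsDiracOn U) {x : M} (hx : x ∈ U) :
    ConcurAt (chartFamily L x) (chartFamily R x) (extChartAt 𝓘(ℝ, E) x x) where
  left_lagrangian := eventually_isLagrangian_chartFamily L x
  right_lagrangian := eventually_isLagrangian_chartFamily R x
  prod_lagrangian := IsLagrangian.cotangentProd
    (isLagrangian_chartFamily L (mem_extChartAt_target x))
    (isLagrangian_chartFamily R (mem_extChartAt_target x))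
  left := ((isDiracOn_iff L isOpen_univ).1 hL x (mem_univ x)).2
  right := ((isDiracOn_iff R isOpen_univ).1 hR x (mem_univ x)).2
  prod := by
    refine ((isDiracOn_iff _ hU).1 hLR x hx).2.congr ?_
    filter_upwards [(isOpen_extChartAt_target (I := 𝓘(ℝ, E)) x).mem_nhds
      (mem_extChartAt_target x)] with z hz
    rw [chartFamily_eq_map L hz, chartFamily_eq_map R hz, chartFamily_eq_map _ hz]
    exact (cotangentProd_map_pairCongr (chartDEquiv hz) (modelFiber L _) (modelFiber R _)).symm

namespace Scheme

variable (C : Scheme)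

omit [FiniteDimensional ℝ E] in
theorem finrank_solutions_chartFamily (S : Bool → LagrangianFamily E M)
    (hy : y ∈ (extChartAt 𝓘(ℝ, E) x₀).target) :
    Module.finrank ℝ (C.solutions fun b => chartFamily (S b) x₀ y) =
      Module.finrank ℝ
        (C.solutions fun b => modelFiber (S b) ((extChartAt 𝓘(ℝ, E) x₀).symm y)) :=
  (finrank_solutions_congr (g := chartDEquiv hy) fun b => mem_chartFamily_congr (S b) hy).symm

/-- A criterion for the family of outputs of a scheme to be involutive. -/
theorem isInvolutive {L R : LagrangianFamily E M} (hL : L.IsDirac) (hR : R.IsDirac)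
    (hLR : L.WeaklyConcur R) (D : LagrangianFamily E M)
    (hD : ∀ x, modelFiber D x =
      (C.solutions fun b => modelFiber (bif b then L else R) x).map C.output)
    (hclosed : ∀ (S : Bool → E → Submodule ℝ (E × (E →L[ℝ] ℝ))) (y : E),
      ConcurAt (S true) (S false) y → ∀ t t' t'' : E → C.Data E,
      SmoothNear t y → SmoothNear t' y → SmoothNear t'' y →
      (∀ᶠ z in 𝓝 y, t z ∈ C.solutions (fun b => S b z)) →
      (∀ᶠ z in 𝓝 y, t' z ∈ C.solutions (fun b => S b z)) →
      (∀ᶠ z in 𝓝 y, t'' z ∈ C.solutions (fun b => S b z)) →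
      courant y (fun z => (C.output (t z)).1) (fun z => (C.output (t z)).2)
        (fun z => (C.output (t' z)).1) (fun z => (C.output (t' z)).2)
        (C.output (t'' y)).1 (C.output (t'' y)).2 = 0) :
    D.IsInvolutive := by
  obtain ⟨U, hU, hUd, hLRU⟩ := hLR
  let S : Bool → LagrangianFamily E M := fun b => bif b then L else R
  -- The dimension is counted in the fibres over `M`, so it does not depend on a chart, while its
  -- semicontinuity is checked in one.
  let f : M → ℕ := fun x => Module.finrank ℝ (C.solutions fun b => modelFiber (S b) x)
  have hS : ∀ x b, FlatSmoothAt (chartFamily (S b) x) (extChartAt 𝓘(ℝ, E) x x) := by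
    intro x b
    cases b
    · exact ((isDiracOn_iff R isOpen_univ).1 hR x (mem_univ x)).1
    · exact ((isDiracOn_iff L isOpen_univ).1 hL x (mem_univ x)).1
  have hSL : ∀ x b, ∀ᶠ z in 𝓝 (extChartAt 𝓘(ℝ, E) x x), IsLagrangian (chartFamily (S b) x z) :=
    fun x b => eventually_isLagrangian_chartFamily _ x
  have hfx : ∀ x, Module.finrank ℝ
      (C.solutions fun b => chartFamily (S b) x (extChartAt 𝓘(ℝ, E) x x)) = f x := by
    intro x
    rw [C.finrank_solutions_chartFamily S (mem_extChartAt_target x),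
      (extChartAt 𝓘(ℝ, E) x).left_inv (mem_extChartAt_source x)]
  have hf : ∀ x, ∀ᶠ x' in 𝓝 x, f x' ≤ f x := by
    intro x
    obtain ⟨V, hV, hxV, -, hVs, hp⟩ := exists_chart_nhds isOpen_univ (mem_univ x)
      (C.eventually_finrank_solutions_le (hS x) (hSL x))
    filter_upwards [hV.mem_nhds hxV] with x' hx'
    have h := hp x' hx'
    rwa [hfx, C.finrank_solutions_chartFamily S ((extChartAt 𝓘(ℝ, E) x).map_source (hVs hx')),
      (extChartAt 𝓘(ℝ, E) x).left_inv (hVs hx')] at h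
  obtain ⟨hWo, hWd⟩ := isOpen_dense_locally_constant hf
  -- The solutions have locally constant dimension on the first set and L ⊛ R is Dirac on the
  -- second; both are open and dense.
  refine ⟨_, hWo.inter hU, hWd.inter_of_isOpen_left hUd hWo, ?_⟩
  rw [isDiracOn_iff _ (hWo.inter hU)]
  rintro x ⟨hx, hxU⟩
  have htarget := (isOpen_extChartAt_target (I := 𝓘(ℝ, E)) x).mem_nhds (mem_extChartAt_target x)
  refine C.flatDirac (S := fun b => chartFamily (S b) x) (hS x) (hSL x) ?_
    (eventually_isLagrangian_chartFamily D x) ?_ ?_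
  · obtain ⟨V, hV, hVo, hxV⟩ := eventually_nhds_iff.1 hx
    filter_upwards [eventually_chart hVo hxV (mem_extChartAt_source x)] with z hz
    rw [hfx, C.finrank_solutions_chartFamily S hz.1]
    exact hV _ hz.2
  · filter_upwards [htarget] with z hz
    ext c
    obtain ⟨⟨v, ξ⟩, rfl⟩ := (pairCongr (chartDEquiv hz)).surjective c
    refine (mem_chartFamily_congr D hz v ξ).trans ?_
    rw [hD]
    exact (map_output_congr (g := chartDEquiv hz)
      (fun b => mem_chartFamily_congr (S b) hz) v ξ).symm
  · exact hclosed (fun b => chartFamily (S b) x) _ (concurAt_chartFamily hL hR hU hLRU hxU)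

end Scheme

end Transfer

/-! ### The schemes of Magri's recipe and their outputs -/

namespace Scheme

variable {E : Type*} [NormedAddCommGroup E] [NormedSpace ℝ E] {C : Scheme}
  {S : Bool → E → Submodule ℝ (E × (E →L[ℝ] ℝ))} {y : E} {t t' t'' : E → C.Data E}

theorem isSec (ht : SmoothNear t y) (hs : ∀ᶠ z in 𝓝 y, t z ∈ C.solutions (fun b => S b z))
    (j : Fin C.conds) :
    IsSec (S (C.side j)) y (fun z => (t z).1 (C.vec j))
      (fun z => (C.form j).elim 0 (t z).2) where
  vec := by
    filter_upwards [ht] with z hz using contDiffAt_pi.1 hz.fst _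
  form := by
    cases C.form j with
    | none => exact SmoothNear.const 0 y
    | some i => filter_upwards [ht] with z hz using contDiffAt_pi.1 hz.snd i
  mem := hs.mono fun _ hz => mem_solutions.1 hz j

/-- The data `p + ζ ∈ L`, `r + ζ ∈ R`, `r ∈ L`, `v + ξ ∈ L`, `v + η ∈ R`, `w + η ∈ L`, where the
vectors `p, r, v, w` and the forms `ξ, ζ, η` are numbered in this order. The output is `ξ` plus the
sum of the vectors in `s`. -/
def magri (s : Finset (Fin 4)) : Scheme where
  vecs := 4
  forms := 3
  conds := 6
  side := ![true, false, true, true, false, true]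
  vec := ![0, 1, 1, 2, 2, 3]
  form := ![some 1, some 1, none, some 0, some 2, some 2]
  outVec := s
  outForm := 0

/-- The data of `Scheme.magri`, together with `u + ξ ∈ R`; the output is `u + p + ξ`. -/
def magriRight : Scheme where
  vecs := 5
  forms := 3
  conds := 7
  side := ![true, false, true, true, false, true, false]
  vec := ![0, 1, 1, 2, 2, 3, 4]
  form := ![some 1, some 1, none, some 0, some 2, some 2, some 0]
  outVec := {4, 0}
  outForm := 0

/-- The data of `Scheme.magri` for `(L, R)` and for `(R, L)`, with the same form `ξ`; the output is
`p + p' + ξ`. -/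
def magriPair : Scheme where
  vecs := 8
  forms := 5
  conds := 12
  side := ![true, false, true, true, false, true, false, true, false, false, true, false]
  vec := ![0, 1, 1, 2, 2, 3, 4, 5, 5, 6, 6, 7]
  form := ![some 1, some 1, none, some 0, some 2, some 2, some 3, some 3, none, some 0, some 4,
    some 4]
  outVec := {0, 4}
  outForm := 0

section Solutions

variable {V : Type*} [AddCommGroup V] [Module ℝ V] [TopologicalSpace V]
  [IsTopologicalAddGroup V] [ContinuousSMul ℝ V] {F : Bool → Submodule ℝ (V × (V →L[ℝ] ℝ))}

omit [IsTopologicalAddGroup V] [ContinuousSMul ℝ V] in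
theorem mem_solutions_magri {s : Finset (Fin 4)} {x : Fin 4 → V} {α : Fin 3 → V →L[ℝ] ℝ} :
    (x, α) ∈ (magri s).solutions F ↔ (x 0, α 1) ∈ F true ∧ (x 1, α 1) ∈ F false ∧
      (x 1, 0) ∈ F true ∧ (x 2, α 0) ∈ F true ∧ (x 2, α 2) ∈ F false ∧ (x 3, α 2) ∈ F true := by
  refine mem_solutions.trans ⟨fun h => ⟨h (0 : Fin 6), h (1 : Fin 6),
    h (2 : Fin 6), h (3 : Fin 6), h (4 : Fin 6), h (5 : Fin 6)⟩, ?_⟩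
  rintro ⟨h0, h1, h2, h3, h4, h5⟩ (j : Fin 6)
  fin_cases j <;> assumption

omit [IsTopologicalAddGroup V] [ContinuousSMul ℝ V] in
theorem mem_solutions_magriRight {x : Fin 5 → V} {α : Fin 3 → V →L[ℝ] ℝ} :
    (x, α) ∈ magriRight.solutions F ↔ (x 0, α 1) ∈ F true ∧ (x 1, α 1) ∈ F false ∧
      (x 1, 0) ∈ F true ∧ (x 2, α 0) ∈ F true ∧ (x 2, α 2) ∈ F false ∧ (x 3, α 2) ∈ F true ∧
      (x 4, α 0) ∈ F false := by
  refine mem_solutions.trans ⟨fun h => ⟨h (0 : Fin 7), h (1 : Fin 7),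
    h (2 : Fin 7), h (3 : Fin 7), h (4 : Fin 7), h (5 : Fin 7), h (6 : Fin 7)⟩, ?_⟩
  rintro ⟨h0, h1, h2, h3, h4, h5, h6⟩ (j : Fin 7)
  fin_cases j <;> assumption

omit [IsTopologicalAddGroup V] [ContinuousSMul ℝ V] in
theorem mem_solutions_magriPair {x : Fin 8 → V} {α : Fin 5 → V →L[ℝ] ℝ} :
    (x, α) ∈ magriPair.solutions F ↔ ((x 0, α 1) ∈ F true ∧ (x 1, α 1) ∈ F false ∧
      (x 1, 0) ∈ F true ∧ (x 2, α 0) ∈ F true ∧ (x 2, α 2) ∈ F false ∧ (x 3, α 2) ∈ F true) ∧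
      (x 4, α 3) ∈ F false ∧ (x 5, α 3) ∈ F true ∧
      (x 5, 0) ∈ F false ∧ (x 6, α 0) ∈ F false ∧ (x 6, α 4) ∈ F true ∧ (x 7, α 4) ∈ F false := by
  refine mem_solutions.trans ⟨fun h => ⟨⟨h (0 : Fin 12), h (1 : Fin 12),
    h (2 : Fin 12), h (3 : Fin 12), h (4 : Fin 12), h (5 : Fin 12)⟩, h (6 : Fin 12), h (7 : Fin 12),
    h (8 : Fin 12), h (9 : Fin 12), h (10 : Fin 12), h (11 : Fin 12)⟩, ?_⟩
  rintro ⟨⟨h0, h1, h2, h3, h4, h5⟩, h6, h7, h8, h9, h10, h11⟩ (j : Fin 12)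
  fin_cases j <;> assumption

omit [IsTopologicalAddGroup V] [ContinuousSMul ℝ V] in
theorem output_magri_singleton (d : (magri {0}).Data V) :
    ((magri {0}).output d).1 = d.1 (0 : Fin 4) :=
  Finset.sum_singleton _ _

omit [IsTopologicalAddGroup V] [ContinuousSMul ℝ V] in
theorem output_magri_pair (d : (magri {2, 0}).Data V) :
    ((magri {2, 0}).output d).1 = d.1 (2 : Fin 4) + d.1 (0 : Fin 4) :=
  Finset.sum_pair (f := d.1) (by decide : (2 : Fin 4) ≠ 0)

omit [IsTopologicalAddGroup V] [ContinuousSMul ℝ V] in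
theorem output_magriRight (d : magriRight.Data V) :
    (magriRight.output d).1 = d.1 (4 : Fin 5) + d.1 (0 : Fin 5) :=
  Finset.sum_pair (f := d.1) (by decide : (4 : Fin 5) ≠ 0)

omit [IsTopologicalAddGroup V] [ContinuousSMul ℝ V] in
theorem output_magriPair (d : magriPair.Data V) :
    (magriPair.output d).1 = d.1 (0 : Fin 8) + d.1 (4 : Fin 8) :=
  Finset.sum_pair (f := d.1) (by decide : (0 : Fin 8) ≠ 4)

omit [IsTopologicalAddGroup V] [ContinuousSMul ℝ V] in
theorem output_magri_snd {s : Finset (Fin 4)} (d : (magri s).Data V) :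
    ((magri s).output d).2 = d.2 (0 : Fin 3) :=
  rfl

omit [IsTopologicalAddGroup V] [ContinuousSMul ℝ V] in
theorem output_magriRight_snd (d : magriRight.Data V) :
    (magriRight.output d).2 = d.2 (0 : Fin 3) :=
  rfl

omit [IsTopologicalAddGroup V] [ContinuousSMul ℝ V] in
theorem output_magriPair_snd (d : magriPair.Data V) :
    (magriPair.output d).2 = d.2 (0 : Fin 5) :=
  rfl

variable [T2Space V] [FiniteDimensional ℝ V]

theorem map_output_magri_graph (hL : IsLagrangian (F true)) (hR : IsLagrangian (F false)) :
    ((magri {0}).solutions F).map (magri {0}).output =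
      graph (magriKernel (F true) (F false)) := by
  ext c
  rw [mem_graph_magriKernel_iff hL hR]
  constructor
  · rintro ⟨⟨(x : Fin 4 → V), (α : Fin 3 → V →L[ℝ] ℝ)⟩, h, rfl⟩
    obtain ⟨h0, h1, h2, h3, h4, h5⟩ := mem_solutions_magri.1 h
    rw [output_magri_singleton]
    exact ⟨⟨_, _, h0, h1, h2⟩, _, _, _, h3, h4, h5⟩
  · rintro ⟨⟨r, ζ, h0, h1, h2⟩, v, w, η, h3, h4, h5⟩
    exact ⟨(![c.1, r, v, w], ![c.2, ζ, η]), mem_solutions_magri.2 ⟨h0, h1, h2, h3, h4, h5⟩,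
      Prod.ext (output_magri_singleton _) rfl⟩

theorem map_output_magri_left (hL : IsLagrangian (F true)) (hR : IsLagrangian (F false)) :
    ((magri {2, 0}).solutions F).map (magri {2, 0}).output =
      cotangentProd (F true) (graph (magriKernel (F true) (F false))) := by
  ext c
  constructor
  · rintro ⟨⟨(x : Fin 4 → V), (α : Fin 3 → V →L[ℝ] ℝ)⟩, h, rfl⟩
    obtain ⟨h0, h1, h2, h3, h4, h5⟩ := mem_solutions_magri.1 h
    exact ⟨(x 2, α 0), h3, (x 0, α 0), (mem_graph_magriKernel_iff hL hR).2
      ⟨⟨_, _, h0, h1, h2⟩, _, _, _, h3, h4, h5⟩, rfl, Prod.ext (output_magri_pair _) rfl⟩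
  · rintro ⟨⟨u, ξ⟩, hu, ⟨p, ξ'⟩, hp, h, rfl⟩
    obtain rfl : ξ = ξ' := h
    obtain ⟨-, v, w, η, h3, h4, h5⟩ := (mem_graph_magriKernel_iff hL hR).1 hp
    -- Any u with u + ξ ∈ L differs from v by an element of K(L), which lies in the Magri kernel and
    -- is absorbed into p. This is why the scheme needs no separate vector u.
    have huv : (u - v, (0 : V →L[ℝ] ℝ)) ∈ F true := by simpa using (F true).sub_mem hu h3
    obtain ⟨r, ζ, h0, h1, h2⟩ :=
      mem_magriKernel.1 ((magriKernel (F true) (F false)).add_mem hp.1 (mem_magriKernel_of_mem huv))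
    refine ⟨(![p + (u - v), r, v, w], ![ξ, ζ, η]),
      mem_solutions_magri.2 ⟨h0, h1, h2, h3, h4, h5⟩, Prod.ext ((output_magri_pair _).trans ?_) rfl⟩
    change v + (p + (u - v)) = u + p
    abel

theorem map_output_magriRight (hL : IsLagrangian (F true)) (hR : IsLagrangian (F false)) :
    (magriRight.solutions F).map magriRight.output =
      cotangentProd (F false) (graph (magriKernel (F true) (F false))) := by
  ext c
  constructor
  · rintro ⟨⟨(x : Fin 5 → V), (α : Fin 3 → V →L[ℝ] ℝ)⟩, h, rfl⟩
    obtain ⟨h0, h1, h2, h3, h4, h5, h6⟩ := mem_solutions_magriRight.1 h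
    exact ⟨(x 4, α 0), h6, (x 0, α 0), (mem_graph_magriKernel_iff hL hR).2
      ⟨⟨_, _, h0, h1, h2⟩, _, _, _, h3, h4, h5⟩, rfl, Prod.ext (output_magriRight _) rfl⟩
  · rintro ⟨⟨u, ξ⟩, hu, ⟨p, ξ'⟩, hp, h, rfl⟩
    obtain rfl : ξ = ξ' := h
    obtain ⟨⟨r, ζ, h0, h1, h2⟩, v, w, η, h3, h4, h5⟩ := (mem_graph_magriKernel_iff hL hR).1 hp
    exact ⟨(![p, r, v, w, u], ![ξ, ζ, η]),
      mem_solutions_magriRight.2 ⟨h0, h1, h2, h3, h4, h5, hu⟩, Prod.ext (output_magriRight _) rfl⟩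

theorem map_output_magriPair (hL : IsLagrangian (F true)) (hR : IsLagrangian (F false)) :
    (magriPair.solutions F).map magriPair.output =
      cotangentProd (graph (magriKernel (F true) (F false)))
        (graph (magriKernel (F false) (F true))) := by
  ext c
  constructor
  · rintro ⟨⟨(x : Fin 8 → V), (α : Fin 5 → V →L[ℝ] ℝ)⟩, h, rfl⟩
    obtain ⟨⟨h0, h1, h2, h3, h4, h5⟩, h6, h7, h8, h9, h10, h11⟩ := mem_solutions_magriPair.1 h
    exact ⟨(x 0, α 0), (mem_graph_magriKernel_iff hL hR).2
      ⟨⟨_, _, h0, h1, h2⟩, _, _, _, h3, h4, h5⟩, (x 4, α 0), (mem_graph_magriKernel_iff hR hL).2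
      ⟨⟨_, _, h6, h7, h8⟩, _, _, _, h9, h10, h11⟩, rfl, Prod.ext (output_magriPair _) rfl⟩
  · rintro ⟨⟨p, ξ⟩, hp, ⟨p', ξ'⟩, hp', h, rfl⟩
    obtain rfl : ξ = ξ' := h
    obtain ⟨⟨r, ζ, h0, h1, h2⟩, v, w, η, h3, h4, h5⟩ := (mem_graph_magriKernel_iff hL hR).1 hp
    obtain ⟨⟨r', ζ', h6, h7, h8⟩, v', w', η', h9, h10, h11⟩ :=
      (mem_graph_magriKernel_iff hR hL).1 hp'
    exact ⟨(![p, r, v, w, p', r', v', w'], ![ξ, ζ, η, ζ', η']),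
      mem_solutions_magriPair.2 ⟨⟨h0, h1, h2, h3, h4, h5⟩, h6, h7, h8, h9, h10, h11⟩,
      Prod.ext (output_magriPair _) rfl⟩

end Solutions

end Scheme

/-! ### Vanishing of the Courant forms -/

section Closedness

variable {E : Type*} [NormedAddCommGroup E] [NormedSpace ℝ E]
  {L R : E → Submodule ℝ (E × (E →L[ℝ] ℝ))} {y : E}
  {p r v w p' r' v' w' p'' r'' v'' w'' u u' u'' : E → E}
  {ζ ξ η ζ' ξ' η' ζ'' ξ'' η'' : E → E →L[ℝ] ℝ}

namespace ConcurAt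

theorem courant_magri (h : ConcurAt L R y)
    (hp : KernelData L R y p r ζ) (hv : AnnihilatorData L R y v w ξ η)
    (hp' : KernelData L R y p' r' ζ') (hv' : AnnihilatorData L R y v' w' ξ' η')
    (hp'' : KernelData L R y p'' r'' ζ'') (hv'' : AnnihilatorData L R y v'' w'' ξ'' η'') :
    courant y p ξ p' ξ' (p'' y) (ξ'' y) = 0 :=
  courant_graph hp'.left.vec hp''.left.vec hv.left.form hv'.left.form
    (h.eventually_apply_eq_zero hp'' hv') (h.eventually_apply_eq_zero hp' hv)
    (h.eventually_apply_eq_zero hp'' hv) (h.kernel_involutive hp hp' hv'')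
    (h.kernel_involutive hp hp'' hv') (h.kernel_involutive hp' hp'' hv)

theorem courant_magri_left (h : ConcurAt L R y)
    (hp : KernelData L R y p r ζ) (hv : AnnihilatorData L R y v w ξ η)
    (hp' : KernelData L R y p' r' ζ') (hv' : AnnihilatorData L R y v' w' ξ' η')
    (hp'' : KernelData L R y p'' r'' ζ'') (hv'' : AnnihilatorData L R y v'' w'' ξ'' η'') :
    courant y (v + p) ξ (v' + p') ξ' (v'' y + p'' y) (ξ'' y) = 0 :=
  courant_add_graph hv.left.vec hv'.left.vec hp.left.vec hp'.left.vec hv'.left.form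
    hv''.left.form (h.eventually_apply_eq_zero hp' hv'') (h.eventually_apply_eq_zero hp hv')
    (h.eventually_apply_eq_zero hp hv'')
    (h.left_courant hv.left hv'.left hv''.left.mem.self_of_nhds)
    (h.courant_magri hp hv hp' hv' hp'' hv'')
    (h.annihilator_left hv hv' hp'') (h.annihilator_left hv hv'' hp')
    (h.annihilator_left hv' hv'' hp)

theorem courant_magri_right (h : ConcurAt L R y)
    (hp : KernelData L R y p r ζ) (hv : AnnihilatorData L R y v w ξ η) (hu : IsSec R y u ξ)
    (hp' : KernelData L R y p' r' ζ') (hv' : AnnihilatorData L R y v' w' ξ' η')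
    (hu' : IsSec R y u' ξ') (hp'' : KernelData L R y p'' r'' ζ'')
    (hv'' : AnnihilatorData L R y v'' w'' ξ'' η'') (hu'' : IsSec R y u'' ξ'') :
    courant y (u + p) ξ (u' + p') ξ' (u'' y + p'' y) (ξ'' y) = 0 :=
  courant_add_graph hu.vec hu'.vec hp.left.vec hp'.left.vec hv'.left.form
    hv''.left.form (h.eventually_apply_eq_zero hp' hv'') (h.eventually_apply_eq_zero hp hv')
    (h.eventually_apply_eq_zero hp hv'')
    (h.right_courant hu hu' hu''.mem.self_of_nhds)
    (h.courant_magri hp hv hp' hv' hp'' hv'')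
    (h.annihilator_right hv hu hv' hu' hp'') (h.annihilator_right hv hu hv'' hu'' hp')
    (h.annihilator_right hv' hu' hv'' hu'' hp)

/-- The sum of the two distributions in Magri's recipe is involutive. -/
theorem sum_involutive {q s q' s' a b : E → E} {μ μ' η' : E → E →L[ℝ] ℝ} (h : ConcurAt L R y)
    (hp : KernelData L R y p r ζ) (hq : KernelData R L y q s μ)
    (hp' : KernelData L R y p' r' ζ') (hq' : KernelData R L y q' s' μ')
    (hv : AnnihilatorData L R y v w ξ η) (hv' : AnnihilatorData R L y a b ξ η') :
    ξ y (fderiv ℝ (p' + q') y ((p + q) y)) - ξ y (fderiv ℝ (p + q) y ((p' + q') y)) = 0 := by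
  have h1 := h.kernel_involutive hp hp' hv
  have h2 := h.symm.kernel_involutive hq hq' hv'
  have h3 := h.mixed_bracket hp hq' hv hv'
  have h4 := h.mixed_bracket hp' hq hv hv'
  simp only [fderiv_add hp.left.vec.differentiableAt hq.left.vec.differentiableAt,
    fderiv_add hp'.left.vec.differentiableAt hq'.left.vec.differentiableAt, map_add,
    _root_.add_apply, Pi.add_apply]
  linarith

theorem eventually_sum_apply_eq_zero {q s a b : E → E} {μ η' : E → E →L[ℝ] ℝ}
    (h : ConcurAt L R y) (hp : KernelData L R y p r ζ) (hq : KernelData R L y q s μ)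
    (hv : AnnihilatorData L R y v w ξ η) (hv' : AnnihilatorData R L y a b ξ η') :
    ∀ᶠ z in 𝓝 y, ξ z ((p + q) z) = 0 := by
  filter_upwards [h.eventually_apply_eq_zero hp hv, h.symm.eventually_apply_eq_zero hq hv'] with
    z h1 h2
  rw [Pi.add_apply, map_add, h1, h2, add_zero]

end ConcurAt

end Closedness

/-! ### Courant forms of scheme outputs -/

namespace Scheme

variable {E : Type*} [NormedAddCommGroup E] [NormedSpace ℝ E]
  {S : Bool → E → Submodule ℝ (E × (E →L[ℝ] ℝ))} {y : E}

theorem data_magri {s : Finset (Fin 4)} {t : E → (magri s).Data E} (ht : SmoothNear t y)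
    (hs : ∀ᶠ z in 𝓝 y, t z ∈ (magri s).solutions (fun b => S b z)) :
    KernelData (S true) (S false) y (fun z => (t z).1 (0 : Fin 4)) (fun z => (t z).1 (1 : Fin 4))
      (fun z => (t z).2 (1 : Fin 3)) ∧
    AnnihilatorData (S true) (S false) y (fun z => (t z).1 (2 : Fin 4))
      (fun z => (t z).1 (3 : Fin 4)) (fun z => (t z).2 (0 : Fin 3))
      (fun z => (t z).2 (2 : Fin 3)) :=
  have h := isSec ht hs
  ⟨⟨h (0 : Fin 6), h (1 : Fin 6), h (2 : Fin 6)⟩, ⟨h (3 : Fin 6), h (4 : Fin 6), h (5 : Fin 6)⟩⟩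

theorem data_magriRight {t : E → magriRight.Data E} (ht : SmoothNear t y)
    (hs : ∀ᶠ z in 𝓝 y, t z ∈ magriRight.solutions (fun b => S b z)) :
    KernelData (S true) (S false) y (fun z => (t z).1 (0 : Fin 5)) (fun z => (t z).1 (1 : Fin 5))
      (fun z => (t z).2 (1 : Fin 3)) ∧
    AnnihilatorData (S true) (S false) y (fun z => (t z).1 (2 : Fin 5))
      (fun z => (t z).1 (3 : Fin 5)) (fun z => (t z).2 (0 : Fin 3))
      (fun z => (t z).2 (2 : Fin 3)) ∧
    IsSec (S false) y (fun z => (t z).1 (4 : Fin 5)) (fun z => (t z).2 (0 : Fin 3)) :=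
  have h := isSec ht hs
  ⟨⟨h (0 : Fin 7), h (1 : Fin 7), h (2 : Fin 7)⟩, ⟨h (3 : Fin 7), h (4 : Fin 7), h (5 : Fin 7)⟩,
    h (6 : Fin 7)⟩

theorem data_magriPair {t : E → magriPair.Data E} (ht : SmoothNear t y)
    (hs : ∀ᶠ z in 𝓝 y, t z ∈ magriPair.solutions (fun b => S b z)) :
    (KernelData (S true) (S false) y (fun z => (t z).1 (0 : Fin 8)) (fun z => (t z).1 (1 : Fin 8))
      (fun z => (t z).2 (1 : Fin 5)) ∧
    AnnihilatorData (S true) (S false) y (fun z => (t z).1 (2 : Fin 8))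
      (fun z => (t z).1 (3 : Fin 8)) (fun z => (t z).2 (0 : Fin 5))
      (fun z => (t z).2 (2 : Fin 5))) ∧
    KernelData (S false) (S true) y (fun z => (t z).1 (4 : Fin 8)) (fun z => (t z).1 (5 : Fin 8))
      (fun z => (t z).2 (3 : Fin 5)) ∧
    AnnihilatorData (S false) (S true) y (fun z => (t z).1 (6 : Fin 8))
      (fun z => (t z).1 (7 : Fin 8)) (fun z => (t z).2 (0 : Fin 5))
      (fun z => (t z).2 (4 : Fin 5)) :=
  have h := isSec ht hs
  ⟨⟨⟨h (0 : Fin 12), h (1 : Fin 12), h (2 : Fin 12)⟩,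
      ⟨h (3 : Fin 12), h (4 : Fin 12), h (5 : Fin 12)⟩⟩,
    ⟨h (6 : Fin 12), h (7 : Fin 12), h (8 : Fin 12)⟩,
    ⟨h (9 : Fin 12), h (10 : Fin 12), h (11 : Fin 12)⟩⟩

theorem courant_output_magri_singleton (h : ConcurAt (S true) (S false) y)
    {t t' t'' : E → (magri {0}).Data E}
    (ht : SmoothNear t y) (ht' : SmoothNear t' y) (ht'' : SmoothNear t'' y)
    (hs : ∀ᶠ z in 𝓝 y, t z ∈ (magri {0}).solutions (fun b => S b z))
    (hs' : ∀ᶠ z in 𝓝 y, t' z ∈ (magri {0}).solutions (fun b => S b z))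
    (hs'' : ∀ᶠ z in 𝓝 y, t'' z ∈ (magri {0}).solutions (fun b => S b z)) :
    courant y (fun z => ((magri {0}).output (t z)).1) (fun z => ((magri {0}).output (t z)).2)
      (fun z => ((magri {0}).output (t' z)).1) (fun z => ((magri {0}).output (t' z)).2)
      ((magri {0}).output (t'' y)).1 ((magri {0}).output (t'' y)).2 = 0 := by
  obtain ⟨hp, hv⟩ := data_magri ht hs
  obtain ⟨hp', hv'⟩ := data_magri ht' hs'
  obtain ⟨hp'', hv''⟩ := data_magri ht'' hs''
  simp only [output_magri_singleton, output_magri_snd]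
  exact h.courant_magri hp hv hp' hv' hp'' hv''

theorem courant_output_magri_pair (h : ConcurAt (S true) (S false) y)
    {t t' t'' : E → (magri {2, 0}).Data E}
    (ht : SmoothNear t y) (ht' : SmoothNear t' y) (ht'' : SmoothNear t'' y)
    (hs : ∀ᶠ z in 𝓝 y, t z ∈ (magri {2, 0}).solutions (fun b => S b z))
    (hs' : ∀ᶠ z in 𝓝 y, t' z ∈ (magri {2, 0}).solutions (fun b => S b z))
    (hs'' : ∀ᶠ z in 𝓝 y, t'' z ∈ (magri {2, 0}).solutions (fun b => S b z)) :
    courant y (fun z => ((magri {2, 0}).output (t z)).1) (fun z => ((magri {2, 0}).output (t z)).2)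
      (fun z => ((magri {2, 0}).output (t' z)).1) (fun z => ((magri {2, 0}).output (t' z)).2)
      ((magri {2, 0}).output (t'' y)).1 ((magri {2, 0}).output (t'' y)).2 = 0 := by
  obtain ⟨hp, hv⟩ := data_magri ht hs
  obtain ⟨hp', hv'⟩ := data_magri ht' hs'
  obtain ⟨hp'', hv''⟩ := data_magri ht'' hs''
  simp only [output_magri_pair, output_magri_snd]
  exact h.courant_magri_left hp hv hp' hv' hp'' hv''

theorem courant_output_magriRight (h : ConcurAt (S true) (S false) y)
    {t t' t'' : E → magriRight.Data E}
    (ht : SmoothNear t y) (ht' : SmoothNear t' y) (ht'' : SmoothNear t'' y)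
    (hs : ∀ᶠ z in 𝓝 y, t z ∈ magriRight.solutions (fun b => S b z))
    (hs' : ∀ᶠ z in 𝓝 y, t' z ∈ magriRight.solutions (fun b => S b z))
    (hs'' : ∀ᶠ z in 𝓝 y, t'' z ∈ magriRight.solutions (fun b => S b z)) :
    courant y (fun z => (magriRight.output (t z)).1) (fun z => (magriRight.output (t z)).2)
      (fun z => (magriRight.output (t' z)).1) (fun z => (magriRight.output (t' z)).2)
      (magriRight.output (t'' y)).1 (magriRight.output (t'' y)).2 = 0 := by
  obtain ⟨hp, hv, hu⟩ := data_magriRight ht hs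
  obtain ⟨hp', hv', hu'⟩ := data_magriRight ht' hs'
  obtain ⟨hp'', hv'', hu''⟩ := data_magriRight ht'' hs''
  simp only [output_magriRight, output_magriRight_snd]
  exact h.courant_magri_right hp hv hu hp' hv' hu' hp'' hv'' hu''

theorem courant_output_magriPair (h : ConcurAt (S true) (S false) y)
    {t t' t'' : E → magriPair.Data E}
    (ht : SmoothNear t y) (ht' : SmoothNear t' y) (ht'' : SmoothNear t'' y)
    (hs : ∀ᶠ z in 𝓝 y, t z ∈ magriPair.solutions (fun b => S b z))
    (hs' : ∀ᶠ z in 𝓝 y, t' z ∈ magriPair.solutions (fun b => S b z))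
    (hs'' : ∀ᶠ z in 𝓝 y, t'' z ∈ magriPair.solutions (fun b => S b z)) :
    courant y (fun z => (magriPair.output (t z)).1) (fun z => (magriPair.output (t z)).2)
      (fun z => (magriPair.output (t' z)).1) (fun z => (magriPair.output (t' z)).2)
      (magriPair.output (t'' y)).1 (magriPair.output (t'' y)).2 = 0 := by
  obtain ⟨⟨hp, hv⟩, hq, hw⟩ := data_magriPair ht hs
  obtain ⟨⟨hp', hv'⟩, hq', hw'⟩ := data_magriPair ht' hs'
  obtain ⟨⟨hp'', hv''⟩, hq'', hw''⟩ := data_magriPair ht'' hs''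
  simp only [output_magriPair, output_magriPair_snd]
  exact courant_graph (hp'.left.vec.add hq'.left.vec) (hp''.left.vec.add hq''.left.vec)
    hv.left.form hv'.left.form (h.eventually_sum_apply_eq_zero hp'' hq'' hv' hw')
    (h.eventually_sum_apply_eq_zero hp' hq' hv hw)
    (h.eventually_sum_apply_eq_zero hp'' hq'' hv hw) (h.sum_involutive hp hq hp' hq' hv'' hw'')
    (h.sum_involutive hp hq hp'' hq'' hv' hw') (h.sum_involutive hp' hq' hp'' hq'' hv hw)

end Scheme

/-! ### Involutivity, weak concurrence and the Poisson case -/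

namespace LagrangianFamily

variable {E : Type*} [NormedAddCommGroup E] [NormedSpace ℝ E] [FiniteDimensional ℝ E]
  {M : Type*} [TopologicalSpace M] [ChartedSpace E M] [IsManifold 𝓘(ℝ, E) ∞ M]
  {L R : LagrangianFamily E M}

omit [IsManifold 𝓘(ℝ, E) ∞ M] in
theorem cotangentProd_comm (L R : LagrangianFamily E M) :
    L.cotangentProd R = R.cotangentProd L :=
  LagrangianFamily.ext (funext fun _ => DiracGeometry.cotangentProd_comm _ _)

theorem WeaklyConcur.symm (h : L.WeaklyConcur R) : R.WeaklyConcur L := by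
  rwa [WeaklyConcur, cotangentProd_comm]

theorem isInvolutive_magri (hL : L.IsDirac) (hR : R.IsDirac) (hLR : L.WeaklyConcur R) :
    (L.magri R).IsInvolutive := by
  have hD : ∀ x, modelFiber (L.magri R) x = ((Scheme.magri {0}).solutions fun b =>
      modelFiber (bif b then L else R) x).map (Scheme.magri {0}).output := fun x =>
    (Scheme.map_output_magri_graph (F := fun b => modelFiber (bif b then L else R) x)
      (isLagrangian_modelFiber L x) (isLagrangian_modelFiber R x)).symm
  exact (Scheme.magri {0}).isInvolutive hL hR hLR _ hD
    fun _ _ h _ _ _ => Scheme.courant_output_magri_singleton h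

theorem weaklyConcur_magri_left (hL : L.IsDirac) (hR : R.IsDirac) (hLR : L.WeaklyConcur R) :
    L.WeaklyConcur (L.magri R) := by
  have hD : ∀ x, modelFiber (L.cotangentProd (L.magri R)) x =
      ((Scheme.magri {2, 0}).solutions fun b =>
        modelFiber (bif b then L else R) x).map (Scheme.magri {2, 0}).output := fun x =>
    (Scheme.map_output_magri_left (F := fun b => modelFiber (bif b then L else R) x)
      (isLagrangian_modelFiber L x) (isLagrangian_modelFiber R x)).symm
  exact (Scheme.magri {2, 0}).isInvolutive hL hR hLR _ hD
    fun _ _ h _ _ _ => Scheme.courant_output_magri_pair h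

theorem weaklyConcur_magri_right (hL : L.IsDirac) (hR : R.IsDirac) (hLR : L.WeaklyConcur R) :
    R.WeaklyConcur (L.magri R) := by
  have hD : ∀ x, modelFiber (R.cotangentProd (L.magri R)) x =
      (Scheme.magriRight.solutions fun b =>
        modelFiber (bif b then L else R) x).map Scheme.magriRight.output := fun x =>
    (Scheme.map_output_magriRight (F := fun b => modelFiber (bif b then L else R) x)
      (isLagrangian_modelFiber L x) (isLagrangian_modelFiber R x)).symm
  exact Scheme.magriRight.isInvolutive hL hR hLR _ hD
    fun _ _ h _ _ _ => Scheme.courant_output_magriRight h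

theorem weaklyConcur_magri_magri (hL : L.IsDirac) (hR : R.IsDirac) (hLR : L.WeaklyConcur R) :
    (L.magri R).WeaklyConcur (R.magri L) := by
  have hD : ∀ x, modelFiber ((L.magri R).cotangentProd (R.magri L)) x =
      (Scheme.magriPair.solutions fun b =>
        modelFiber (bif b then L else R) x).map Scheme.magriPair.output := fun x =>
    (Scheme.map_output_magriPair (F := fun b => modelFiber (bif b then L else R) x)
      (isLagrangian_modelFiber L x) (isLagrangian_modelFiber R x)).symm
  exact Scheme.magriPair.isInvolutive hL hR hLR _ hD
    fun _ _ h _ _ _ => Scheme.courant_output_magriPair h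

theorem pairwise_weaklyConcur_magri (hL : L.IsDirac) (hR : R.IsDirac) (hLR : L.WeaklyConcur R) :
    List.Pairwise WeaklyConcur [L, R, L.magri R, R.magri L] := by
  simp only [List.pairwise_cons, List.mem_cons, List.not_mem_nil, or_false, forall_eq_or_imp,
    forall_eq, false_implies, implies_true, List.Pairwise.nil, and_true]
  -- The pairs containing ℳ(R, L) and one of L, R come from the same two results with L and R
  -- exchanged.
  exact ⟨⟨hLR, weaklyConcur_magri_left hL hR hLR, weaklyConcur_magri_right hR hL hLR.symm⟩,
    ⟨weaklyConcur_magri_right hL hR hLR, weaklyConcur_magri_left hR hL hLR.symm⟩,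
    weaklyConcur_magri_magri hL hR hLR⟩

-- In the description of the kernel, r ∈ L now forces r = π_L(0) = 0. Then r + ζ ∈ R says ζ ∈ ker
-- π_R, and p + ζ ∈ L says p = π_L(ζ).
omit [IsManifold 𝓘(ℝ, E) ∞ M] in
theorem magri_eq_of_isGraphOf
    {πL πR : ∀ x : M, (TangentSpace 𝓘(ℝ, E) x →L[ℝ] ℝ) →ₗ[ℝ] TangentSpace 𝓘(ℝ, E) x}
    (hL : L.IsGraphOf πL) (hR : R.IsGraphOf πR) :
    L.magri R = .graph (fun x => (LinearMap.ker (πR x)).map (πL x)) := by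
  have h : (magriN L R).kernel = fun x => (LinearMap.ker (πR x)).map (πL x) := by
    funext x
    ext p
    refine mem_magriKernel.trans ?_
    simp only [hL x, hR x, Submodule.mem_map, LinearMap.mem_ker, map_zero]
    constructor
    · rintro ⟨r, ζ, rfl, h, rfl⟩
      exact ⟨ζ, h.symm, rfl⟩
    · rintro ⟨ζ, h, rfl⟩
      exact ⟨0, ζ, rfl, h.symm, rfl⟩
  rw [magri, h]

end LagrangianFamily

end DiracGeometry

end

theorem mainTheorem3 {E : Type*} [NormedAddCommGroup E] [NormedSpace ℝ E] [FiniteDimensional ℝ E]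
    {M : Type*} [TopologicalSpace M] [ChartedSpace E M] [IsManifold 𝓘(ℝ, E) ∞ M]
    (L R : DiracGeometry.LagrangianFamily E M) (hL : L.IsDirac) (hR : R.IsDirac) (hLR : L.WeaklyConcur R) :
    (L.magri R).IsInvolutive ∧ (R.magri L).IsInvolutive ∧
      List.Pairwise DiracGeometry.LagrangianFamily.WeaklyConcur
        [L, R, L.magri R, R.magri L] ∧
      ∀ πL πR : (∀ x : M, (TangentSpace 𝓘(ℝ, E) x →L[ℝ] ℝ) →ₗ[ℝ] TangentSpace 𝓘(ℝ, E) x),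
        L.IsGraphOf πL → R.IsGraphOf πR →
          L.magri R = .graph (fun x => (LinearMap.ker (πR x)).map (πL x)) ∧
          R.magri L = .graph (fun x => (LinearMap.ker (πL x)).map (πR x)) :=
  ⟨DiracGeometry.LagrangianFamily.isInvolutive_magri hL hR hLR,
    DiracGeometry.LagrangianFamily.isInvolutive_magri hR hL hLR.symm,
    DiracGeometry.LagrangianFamily.pairwise_weaklyConcur_magri hL hR hLR,
    fun _ _ h h' => ⟨DiracGeometry.LagrangianFamily.magri_eq_of_isGraphOf h h',
      DiracGeometry.LagrangianFamily.magri_eq_of_isGraphOf h' h⟩⟩
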